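/- Let $n \ge 3$ and let $1, 2, \dots, 2n$ be points on the unit circle, labeled clockwise (labels are taken modulo $2n$). The odd points are the vertices of the \emph{hollow} convex $n$-gon, the even points those of the \emph{solid} convex $n$-gon. A hollow (resp. solid) diagonal is a segment joining two distinct hollow (resp. solid) vertices; it is a boundary edge if its endpoints are $i, i+2$ for some $i$, and internal otherwise. Two diagonals cross if their relative interiors meet transversally, i.e. their four endpoints are distinct and alternate around the circle. A hollow dissection $D_\circ$ is a set of pairwise non-crossing internal hollow diagonals; $\overline{D}_\circ$ denotes $D_\circ$ together with the boundary edges of the hollow polygon, and the cells of $D_\circ$ are the closures of the connected components of the hollow polygon minus the diagonals of $D_\circ$. A solid diagonal $\delta_\bullet$ is a \emph{$D_\circ$-accordion diagonal} if the set of diagonals of $\overline{D}_\circ$ crossed by $\delta_\bullet$ is connected. A \emph{$D_\circ$-accordion dissection} is a set of pairwise non-crossing internal $D_\circ$-accordion diagonals, and the \emph{$D_\circ$-accordion complex} is the simplicial complex of all $D_\circ$-accordion dissections (the empty one included). For a $D_\circ$-accordion diagonal $\delta_\bullet$ and $\delta_\circ \in D_\circ$ crossed by $\delta_\bullet$, let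 $\mu_\circ, \nu_\circ$ be the other diagonals of $\overline{D}_\circ$ crossed by $\delta_\bullet$ in the two cells of $D_\circ$ containing $\delta_\circ$. Put $\varepsilon(\delta_\circ, \delta_\bullet) = 1$ if $\mu_\circ = ab$, $\delta_\circ = bc$, $\nu_\circ = cd$ form a path $abcd$ shaped like a $\mathsf{Z}$ (its vertices appear in the clockwise order $a, b, d, c$), $\varepsilon(\delta_\circ, \delta_\bullet) = -1$ if they form a path $abcd$ shaped like an $\mathsf{S}$ (clockwise order $b, a, c, d$), and $\varepsilon(\delta_\circ, \delta_\bullet) = 0$ if $\mu_\circ, \delta_\circ, \nu_\circ$ share a common endpoint; put $\varepsilon(\delta_\circ, \delta_\bullet) = 0$ also if $\delta_\bullet$ does not cross $\delta_\circ$. The \emph{$g$-vector} of $\delta_\bullet$ is $g(\delta_\bullet) = \sum_{\delta_\circ \in D_\circ} \varepsilon(\delta_\circ, \delta_\bullet)\, e_{\delta_\circ} \in \mathbb{R}^{D_\circ}$. For a $D_\circ$-accordion dissection $D_\bullet$, let $C(D_\bullet) = \mathbb{R}_{\ge 0}\{g(\delta_\bullet) : \delta_\bullet \in D_\bullet\}$.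 \textbf{Theorem.} For every hollow dissection $D_\circ$, the collection of cones $$\mathcal{F}^g(D_\circ) = \{\, C(D_\bullet) : D_\bullet \text{ a } D_\circ\text{-accordion dissection} \,\}$$ is a complete simplicial fan in $\mathbb{R}^{D_\circ}$: it is a finite collection of cones, each generated by linearly independent vectors; every face of a cone of the collection is in the collection; any two of its cones meet along a common face; and the cones cover $\mathbb{R}^{D_\circ}$. Moreover this fan realizes the $D_\circ$-accordion complex: for all $D_\circ$-accordion dissections $D_\bullet, D'_\bullet$, the $g$-vectors $g(\delta_\bullet)$, $\delta_\bullet \in D_\bullet$, are linearly independent; $C(D_\bullet)$ is a face of $C(D'_\bullet)$ if and only if $D_\bullet \subseteq D'_\bullet$; and $C(D_\bullet) \cap C(D'_\bullet) = C(D_\bullet \cap D'_\bullet)$. -/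

import Mathlib

/-! ### Hollow and solid diagonals

The `2 * n` labelled points on the unit circle, in clockwise order, are the elements of
`ZMod (2 * n)` (labels are considered modulo `2 * n`): the odd labels are the hollow vertices and
the even labels are the solid vertices.  `sbtw a b c` says that, going clockwise around the circle
from `a`, one meets `b` strictly before `c`, the three points being distinct. -/

/-- A segment between two of the labelled points, given by its unordered pair of endpoints. -/
abbrev Diag (n : ℕ) : Type := Sym2 (ZMod (2 * n))

/-- Diagonals of the hollow polygon (internal diagonals and boundary edges). -/
def IsHollowDiag {n : ℕ} (e : Diag n) : Prop :=
  ∃ a b : ZMod (2 * n), Odd a ∧ Odd b ∧ a ≠ b ∧ e = s(a, b)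

/-- Diagonals of the solid polygon (internal diagonals and boundary edges). -/
def IsSolidDiag {n : ℕ} (e : Diag n) : Prop :=
  ∃ a b : ZMod (2 * n), Even a ∧ Even b ∧ a ≠ b ∧ e = s(a, b)

/-- The two endpoints are consecutive vertices of the hollow (or solid) polygon. -/
def IsBoundaryEdge {n : ℕ} (e : Diag n) : Prop :=
  ∃ a : ZMod (2 * n), e = s(a, a + 2)

/-- Two chords of the circle cross (at a point interior to both) when their four endpoints are
distinct and alternate around the circle. -/
def Crosses {n : ℕ} (e f : Diag n) : Prop :=
  ∃ a b c d : ZMod (2 * n), e = s(a, b) ∧ f = s(c, d) ∧ sbtw a c b ∧ sbtw b d a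

/-- A hollow dissection: a set of pairwise non-crossing internal diagonals of the hollow
polygon. -/
structure IsHollowDissection {n : ℕ} (D : Set (Diag n)) : Prop where
  hollow : ∀ e ∈ D, IsHollowDiag e
  internal : ∀ e ∈ D, ¬ IsBoundaryEdge e
  noncrossing : ∀ e ∈ D, ∀ f ∈ D, ¬ Crosses e f

/-- The dissection `D` together with all boundary edges of the hollow polygon. -/
def withBoundary {n : ℕ} (D : Set (Diag n)) : Set (Diag n) :=
  D ∪ {e | IsHollowDiag e ∧ IsBoundaryEdge e}

/-! ### Accordions and the accordion complex -/

/-- The cut of `D` by the solid diagonal `δ`: the hollow diagonals of `D`, boundary edges included,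
which are crossed by `δ`. -/
def cut {n : ℕ} (D : Set (Diag n)) (δ : Diag n) : Set (Diag n) :=
  {e | e ∈ withBoundary D ∧ Crosses e δ}

/-- A set of diagonals is connected: any two of its members are joined by a sequence of its members
in which successive diagonals share an endpoint. -/
def IsConnectedDiags {n : ℕ} (A : Set (Diag n)) : Prop :=
  ∀ e ∈ A, ∀ f ∈ A, Relation.ReflTransGen (fun x y => y ∈ A ∧ ∃ v, v ∈ x ∧ v ∈ y) e f

/-- `δ` is a `D`-accordion diagonal: a solid diagonal whose cut of `D` is an accordion, that is, a
connected cut. -/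
def IsAccordionDiag {n : ℕ} (D : Set (Diag n)) (δ : Diag n) : Prop :=
  IsSolidDiag δ ∧ IsConnectedDiags (cut D δ)

/-- A `D`-accordion dissection: a set of pairwise non-crossing internal `D`-accordion diagonals. -/
structure IsAccordionDissection {n : ℕ} (D E : Set (Diag n)) : Prop where
  accordion : ∀ δ ∈ E, IsAccordionDiag D δ
  internal : ∀ δ ∈ E, ¬ IsBoundaryEdge δ
  noncrossing : ∀ γ ∈ E, ∀ δ ∈ E, ¬ Crosses γ δ

/-- The `D`-accordion complex, as the set of all its faces (the empty face included). -/
def accordionComplex {n : ℕ} (D : Set (Diag n)) : Set (Set (Diag n)) :=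
  {E | IsAccordionDissection D E}

/-! ### g-vectors -/

/-- `C` is the set of vertices of a cell of `D`: a maximal set of hollow vertices no two of which
are separated by a diagonal of `D`. -/
def IsCell {n : ℕ} (D : Set (Diag n)) (C : Set (ZMod (2 * n))) : Prop :=
  Maximal (fun C : Set (ZMod (2 * n)) =>
    (∀ v ∈ C, Odd v) ∧ ∀ u ∈ C, ∀ v ∈ C, ∀ e ∈ D, ¬ Crosses e s(u, v)) C

/-- `f` is the other diagonal of `withBoundary D` crossed by `δ` in one of the cells of `D`
containing `e`, where `e` is itself crossed by `δ`. -/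
def IsNextCrossed {n : ℕ} (D : Set (Diag n)) (δ e f : Diag n) : Prop :=
  e ∈ cut D δ ∧ f ∈ cut D δ ∧ f ≠ e ∧
    ∃ C, IsCell D C ∧ (∀ v ∈ e, v ∈ C) ∧ (∀ v ∈ f, v ∈ C)

/-- The diagonals crossed by `δ` just before and just after `e` form with `e` a path `a b c d` with
middle edge `e = bc`, shaped like a `Z`: the clockwise order of its vertices is `a, b, d, c`. -/
def FormsZ {n : ℕ} (D : Set (Diag n)) (e δ : Diag n) : Prop :=
  ∃ a b c d : ZMod (2 * n), e = s(b, c) ∧ sbtw c a b ∧ sbtw b d c ∧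
    IsNextCrossed D δ e s(a, b) ∧ IsNextCrossed D δ e s(c, d)

/-- The diagonals crossed by `δ` just before and just after `e` form with `e` a path `a b c d` with
middle edge `e = bc`, shaped like an `S`: the clockwise order of its vertices is `b, a, c, d`. -/
def FormsS {n : ℕ} (D : Set (Diag n)) (e δ : Diag n) : Prop :=
  ∃ a b c d : ZMod (2 * n), e = s(b, c) ∧ sbtw b a c ∧ sbtw c d b ∧
    IsNextCrossed D δ e s(a, b) ∧ IsNextCrossed D δ e s(c, d)

open Classical in
/-- The sign of `e ∈ D` with respect to `δ`: `1` for a `Z`, `-1` for an `S`, and `0` otherwise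
(when the three diagonals share an endpoint, or when `δ` does not cross `e`). -/
noncomputable def slalomSign {n : ℕ} (D : Set (Diag n)) (e δ : Diag n) : ℝ :=
  if FormsZ D e δ then 1 else if FormsS D e δ then -1 else 0

/-- The g-vector of the `D`-accordion diagonal `δ`, a vector of `ℝ^D`. -/
noncomputable def gVector {n : ℕ} (D : Set (Diag n)) (δ : Diag n) : D → ℝ :=
  fun e => slalomSign D e δ

/-- The nonnegative span of the g-vectors of the diagonals of `E`. -/
noncomputable def gCone {n : ℕ} (D E : Set (Diag n)) : PointedCone ℝ (D → ℝ) :=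
  PointedCone.hull ℝ (gVector D '' E)

/-- The collection of the cones of all `D`-accordion dissections. -/
noncomputable def gVectorFan {n : ℕ} (D : Set (Diag n)) : Set (PointedCone ℝ (D → ℝ)) :=
  gCone D '' accordionComplex D

/-! ### Fans -/

/-- A complete simplicial fan in a real vector space: a finite collection of simplicial cones,
containing all faces of its members, in which any two cones meet along a common face, and which
covers the whole space. -/
structure IsCompleteSimplicialFan {V : Type*} [AddCommGroup V] [Module ℝ V]
    (F : Set (PointedCone ℝ V)) : Prop where
  finite : F.Finite
  simplicial : ∀ C ∈ F, C.IsSimplicial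
  face_mem : ∀ C ∈ F, ∀ C' : PointedCone ℝ V, C'.IsFaceOf C → C' ∈ F
  inter_isFaceOf : ∀ C ∈ F, ∀ C' ∈ F, (C ⊓ C').IsFaceOf C ∧ (C ⊓ C').IsFaceOf C'
  complete : ∀ x : V, ∃ C ∈ F, x ∈ C

/-! The argument treats g-vectors as shear coordinates of laminations. Fix `x ∈ ℝ^D`. A leaf is a
path across the hollow polygon, described by a real position on each edge it crosses. It enters a
cell at signed distance `p` from the centre and leaves it by turning around the start of the entry
edge if `p < 0` and around its end if `p > 0`. Crossing an edge `e` shifts the position by `x e`.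
Almost every position on an edge gives a leaf joining two solid vertices, and accordion diagonals
are exactly the diagonals that turn, in each cell, around an endpoint of the edge just crossed. The
weight of an internal accordion diagonal is the length of the set of positions whose leaf joins its
endpoints (`leafWeight`); it does not depend on the crossed edge used to measure it.

Existence: on `e ∈ D`, the leaves forming a `Z` fill an interval of length `max (x e) 0`, and those
forming an `S` one of length `max (-x e) 0`. Hence the g-vectors with these weights sum to `x`
(`sum_leafWeight_mul_slalomSign`). Leaves over a common edge keep their order (`Leaf.mono`), and
crossing accordion diagonals share an edge (`exists_common_edge`), so the diagonals of positive
weight do not cross.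

Uniqueness: let nonnegative weights `w` on an accordion dissection have g-vector sum `x`. Stacking
strips of width `w δ` over each edge gives intervals that move exactly like leaves
(`leaf_of_mem_strip`), so `w ≤ leafWeight`. On each `e ∈ D` the leaves include no `Z` or no `S` of
positive weight, and this forces equality (`eq_leafWeight`).

Thus every vector has exactly one nonnegative expansion with support in an accordion dissection. A
cone is then described by where its coordinates vanish (`mem_gCone_iff_fanCoord`), and all the fan
properties become statements about supports. -/

/-! ### The circular order in linear coordinates -/

section CircularOrder

variable {n : ℕ}

/-- The number of clockwise steps from `o` to `x`. -/
def pos (o x : ZMod (2 * n)) : ℕ := (x - o).val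

theorem pos_self (o : ZMod (2 * n)) : pos o o = 0 := by simp [pos]

/-- Parity survives reduction modulo `2 * n`, as seen by projecting to `ZMod 2`. -/
theorem not_even_of_odd {a : ZMod (2 * n)} (h : Odd a) : ¬ Even a := by
  intro h'
  have h1 := h.map (ZMod.castHom (dvd_mul_right 2 n) (ZMod 2))
  have h2 := h'.map (ZMod.castHom (dvd_mul_right 2 n) (ZMod 2))
  generalize (ZMod.castHom (dvd_mul_right 2 n) (ZMod 2)) a = z at h1 h2
  obtain ⟨u, rfl⟩ := h1
  obtain ⟨v, hv⟩ := h2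
  revert hv; revert u v; decide

theorem ne_of_odd_of_even {a b : ZMod (2 * n)} (ha : Odd a) (hb : Even b) : a ≠ b :=
  fun h => not_even_of_odd ha (h ▸ hb)

theorem crosses_iff {a b s t : ZMod (2 * n)} : Crosses s(a, b) s(s, t) ↔
    (sbtw a t b ∧ sbtw b s a) ∨ (sbtw a s b ∧ sbtw b t a) := by
  constructor
  · rintro ⟨a', b', c, d, h1, h2, h3, h4⟩
    rw [Sym2.eq_iff] at h1 h2
    rcases h1 with ⟨rfl, rfl⟩ | ⟨rfl, rfl⟩ <;> rcases h2 with ⟨rfl, rfl⟩ | ⟨rfl, rfl⟩ <;> tauto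
  · rintro (⟨h1, h2⟩ | ⟨h1, h2⟩)
    · exact ⟨a, b, t, s, rfl, Sym2.eq_swap, h1, h2⟩
    · exact ⟨a, b, s, t, rfl, rfl, h1, h2⟩

theorem pos_natCast_add (a : ZMod (2 * n)) {k : ℕ} (hk : k < 2 * n) : pos a (a + k) = k := by
  simp [pos, ZMod.val_natCast, Nat.mod_eq_of_lt hk]

theorem pos_add_one (hn : 3 ≤ n) (a : ZMod (2 * n)) : pos a (a + 1) = 1 := by
  have := pos_natCast_add a (k := 1) (by omega)
  simpa using this

theorem pos_add_two (hn : 3 ≤ n) (a : ZMod (2 * n)) : pos a (a + 2) = 2 := by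
  have := pos_natCast_add a (k := 2) (by omega)
  simpa using this

variable [NeZero n]

theorem pos_lt (o x : ZMod (2 * n)) : pos o x < 2 * n := ZMod.val_lt _

theorem pos_injective (o : ZMod (2 * n)) : Function.Injective (pos o) := fun x y h => by
  simpa using ZMod.val_injective _ h

theorem pos_eq (o x : ZMod (2 * n)) :
    pos o x = if o.val ≤ x.val then x.val - o.val else x.val + 2 * n - o.val := by
  have ho := ZMod.val_lt o
  have hx := ZMod.val_lt x
  unfold pos
  split_ifs with h
  · exact ZMod.val_sub h
  · have h2 : x = (x - o) + o := by ring
    have h3 := ZMod.val_add (x - o) o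
    rw [← h2] at h3
    have h4 := ZMod.val_lt (x - o)
    rcases Nat.lt_or_ge ((x - o).val + o.val) (2 * n) with h5 | h5
    · rw [Nat.mod_eq_of_lt h5] at h3; omega
    · rw [Nat.mod_eq_sub_mod h5, Nat.mod_eq_of_lt (by omega)] at h3; omega

theorem sbtw_iff_val {x y z : ZMod (2 * n)} : sbtw x y z ↔
    (x.val < y.val ∧ y.val < z.val ∨ y.val < z.val ∧ z.val < x.val ∨
      z.val < x.val ∧ x.val < y.val) := by
  have key : ∀ (m : ℕ) (_ : m ≠ 0) (x y z : ZMod m), sbtw x y z ↔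
      (x.val < y.val ∧ y.val < z.val ∨ y.val < z.val ∧ z.val < x.val ∨
      z.val < x.val ∧ x.val < y.val) := by
    intro m hm
    cases m with
    | zero => exact absurd rfl hm
    | succ m => exact fun x y z => Iff.rfl
  exact key _ (NeZero.ne _) x y z

/-- Cutting the circle at any base point turns the cyclic order into three linear cases, so that
planar arguments below become linear arithmetic on positions. -/
theorem sbtw_iff_pos (o : ZMod (2 * n)) {x y z : ZMod (2 * n)} : sbtw x y z ↔
    (pos o x < pos o y ∧ pos o y < pos o z ∨ pos o y < pos o z ∧ pos o z < pos o x ∨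
      pos o z < pos o x ∧ pos o x < pos o y) := by
  have h1 := ZMod.val_lt o
  have h2 := ZMod.val_lt x
  have h3 := ZMod.val_lt y
  have h4 := ZMod.val_lt z
  rw [sbtw_iff_val, pos_eq, pos_eq, pos_eq]
  split_ifs <;> omega

theorem sbtw_iff_pos_lt {a c b : ZMod (2 * n)} :
    sbtw a c b ↔ 0 < pos a c ∧ pos a c < pos a b := by
  rw [sbtw_iff_pos a, pos_self]; omega

theorem sbtw_iff_lt_pos {a c b : ZMod (2 * n)} :
    sbtw b c a ↔ 0 < pos a b ∧ pos a b < pos a c := by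
  rw [sbtw_iff_pos a, pos_self]; omega

/-- The point `c` lies in the arc cut off by `xy` after `o`. -/
theorem sbtw_iff_of_lt {o x c y : ZMod (2 * n)} (h : pos o x < pos o y) :
    sbtw x c y ↔ pos o x < pos o c ∧ pos o c < pos o y := by
  rw [sbtw_iff_pos o]; omega

theorem sbtw_or_sbtw {a b c : ZMod (2 * n)} (hab : a ≠ b) (hca : c ≠ a) (hcb : c ≠ b) :
    sbtw a c b ∨ sbtw b c a := by
  have h1 := (pos_injective a).ne hab
  have h2 := (pos_injective a).ne hca
  have h3 := (pos_injective a).ne hcb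
  rw [sbtw_iff_pos a, sbtw_iff_pos a]; rw [pos_self] at *; omega

theorem not_sbtw_add_one (hn : 3 ≤ n) (a c : ZMod (2 * n)) : ¬ sbtw a c (a + 1) := by
  rw [sbtw_iff_pos_lt, pos_add_one hn]; omega

theorem sbtw_add_one_add_two (hn : 3 ≤ n) (a : ZMod (2 * n)) : sbtw a (a + 1) (a + 2) := by
  rw [sbtw_iff_pos_lt, pos_add_one hn, pos_add_two hn]; omega

theorem eq_add_one_of_sbtw (hn : 3 ≤ n) {a c : ZMod (2 * n)} (h : sbtw a c (a + 2)) :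
    c = a + 1 := by
  rw [sbtw_iff_pos_lt, pos_add_two hn] at h
  apply pos_injective a
  rw [pos_add_one hn]; omega

theorem sbtw_add_two (hn : 3 ≤ n) {a b : ZMod (2 * n)} (ha : Odd a) (hb : Odd b) (hab : a ≠ b)
    (h : b ≠ a + 2) : sbtw a (a + 2) b := by
  have h0 := (pos_injective a).ne hab
  have h1 := (pos_injective a).ne h
  have h2 : pos a b ≠ pos a (a + 1) :=
    (pos_injective a).ne (ne_of_odd_of_even hb (ha.add_odd odd_one))
  rw [pos_add_one hn] at h2
  rw [sbtw_iff_pos_lt, pos_add_two hn] at *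
  rw [pos_self] at h0
  omega

theorem sbtw_ne {a b c : ZMod (2 * n)} (h : sbtw a b c) : a ≠ b ∧ b ≠ c ∧ a ≠ c := by
  rw [sbtw_iff_pos a] at h
  refine ⟨?_, ?_, ?_⟩ <;> rintro rfl <;> omega

end CircularOrder

/-! ### Directed edges and the two ways to cross a cell -/

section Edges

variable {n : ℕ} {D : Set (Diag n)}

/-- The directed edge from `a` to `b` is a diagonal of `D` or a boundary edge.  It is thought of as
being crossed towards the clockwise arc from `a` to `b`. -/
def IsEdge (D : Set (Diag n)) (a b : ZMod (2 * n)) : Prop := s(a, b) ∈ withBoundary D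

theorem IsEdge.symm {a b : ZMod (2 * n)} (h : IsEdge D a b) : IsEdge D b a := by
  unfold IsEdge; rwa [Sym2.eq_swap]

theorem IsEdge.odd (hD : IsHollowDissection D) {a b : ZMod (2 * n)} (h : IsEdge D a b) :
    Odd a ∧ Odd b ∧ a ≠ b := by
  have h1 : IsHollowDiag s(a, b) := by
    rcases h with h | h
    · exact hD.hollow _ h
    · exact h.1
  obtain ⟨u, v, hu, hv, huv, h⟩ := h1
  rcases Sym2.eq_iff.1 h with ⟨rfl, rfl⟩ | ⟨rfl, rfl⟩
  · exact ⟨hu, hv, huv⟩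
  · exact ⟨hv, hu, huv.symm⟩

/-- The edge following `ab` around its start `a`. -/
structure IsNextStart (D : Set (Diag n)) (a b a' : ZMod (2 * n)) : Prop where
  edge : IsEdge D a a'
  sbtw : sbtw a a' b
  max : ∀ c, IsEdge D a c → ¬ SBtw.sbtw a' c b

/-- The edge following `ab` around its end `b`. -/
structure IsNextEnd (D : Set (Diag n)) (a b b' : ZMod (2 * n)) : Prop where
  edge : IsEdge D b' b
  sbtw : sbtw a b' b
  max : ∀ c, IsEdge D c b → ¬ SBtw.sbtw a c b'

/-- Two consecutive edges at a vertex, seen from the other side: reversing a path exchanges turns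
around the start with turns around the end. -/
theorem IsNextStart.flip {a b a' : ZMod (2 * n)} (hab : IsEdge D a b)
    (h : IsNextStart D a b a') : IsNextEnd D a' a b :=
  ⟨hab.symm, h.sbtw.cyclic_left, fun c hc => h.max c hc.symm⟩

theorem IsNextEnd.flip {a b b' : ZMod (2 * n)} (hab : IsEdge D a b)
    (h : IsNextEnd D a b b') : IsNextStart D b b' a :=
  ⟨hab.symm, h.sbtw.cyclic_right, fun c hc => h.max c hc.symm⟩

theorem mem_of_isEdge {a b : ZMod (2 * n)} (h : IsEdge D a b) (h1 : b ≠ a + 2)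
    (h2 : a ≠ b + 2) : s(a, b) ∈ D := by
  rcases h with h | ⟨-, u, hu⟩
  · exact h
  · rcases Sym2.eq_iff.1 hu with ⟨rfl, rfl⟩ | ⟨rfl, rfl⟩ <;> contradiction

variable [NeZero n]

theorem isEdge_add_two (hn : 3 ≤ n) {a : ZMod (2 * n)} (ha : Odd a) : IsEdge D a (a + 2) := by
  refine Or.inr ⟨⟨a, a + 2, ha, ha.add_even even_two, ?_, rfl⟩, a, rfl⟩
  intro h
  have := pos_add_two hn a
  rw [← h, pos_self] at this
  omega

theorem IsEdge.not_crosses (hn : 3 ≤ n) (hD : IsHollowDissection D) {a b c d : ZMod (2 * n)}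
    (hab : IsEdge D a b) (hcd : IsEdge D c d) : ¬ (sbtw a c b ∧ sbtw b d a) := by
  rintro ⟨h1, h2⟩
  have key : ∀ {a b c d : ZMod (2 * n)}, IsEdge D a b → IsEdge D c d → sbtw a c b → sbtw b d a →
      IsBoundaryEdge s(a, b) → False := by
    intro a b c d hab hcd h1 h2 h3
    obtain ⟨u, hu⟩ := h3
    obtain ⟨oa, ob, -⟩ := hab.odd hD
    obtain ⟨oc, od, -⟩ := hcd.odd hD
    rcases Sym2.eq_iff.1 hu with ⟨rfl, rfl⟩ | ⟨rfl, rfl⟩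
    · exact ne_of_odd_of_even oc (oa.add_odd odd_one) (eq_add_one_of_sbtw hn h1)
    · exact ne_of_odd_of_even od (ob.add_odd odd_one) (eq_add_one_of_sbtw hn h2)
  -- A boundary edge cuts off a single point, which is even, so no hollow diagonal can cross it.
  rcases hab with h | h
  · rcases hcd with h' | h'
    · exact hD.noncrossing _ h _ h' ⟨a, b, c, d, rfl, rfl, h1, h2⟩
    · refine key (Or.inr h' : IsEdge D c d) (IsEdge.symm (Or.inl h)) ?_ ?_ h'.2 <;>
      · simp only [sbtw_iff_pos a] at *
        rw [pos_self] at *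
        omega
  · exact key (Or.inr h) hcd h1 h2 h.2

theorem IsNextStart.ne (hn : 3 ≤ n) (hD : IsHollowDissection D) {a b a' : ZMod (2 * n)}
    (h : IsNextStart D a b a') : b ≠ a + 2 := by
  rintro rfl
  obtain ⟨oa, ob, -⟩ := h.edge.odd hD
  exact ne_of_odd_of_even ob (oa.add_odd odd_one) (eq_add_one_of_sbtw hn h.sbtw)

theorem IsNextEnd.ne (hn : 3 ≤ n) (hD : IsHollowDissection D) {a b b' : ZMod (2 * n)}
    (hab : IsEdge D a b) (h : IsNextEnd D a b b') : b ≠ a + 2 := by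
  rintro rfl
  obtain ⟨oa, ob, -⟩ := h.edge.odd hD
  exact ne_of_odd_of_even oa ((hab.odd hD).1.add_odd odd_one) (eq_add_one_of_sbtw hn h.sbtw)

theorem exists_isNextStart (hn : 3 ≤ n) (hD : IsHollowDissection D) {a b : ZMod (2 * n)}
    (h : IsEdge D a b) (hb : b ≠ a + 2) : ∃ a', IsNextStart D a b a' := by
  obtain ⟨oa, ob, hab⟩ := h.odd hD
  obtain ⟨c, ⟨hc1, hc2⟩, hc3⟩ := Set.exists_max_image {c | IsEdge D a c ∧ sbtw a c b} (pos a)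
    (Set.toFinite _) ⟨a + 2, isEdge_add_two hn oa, sbtw_add_two hn oa ob hab hb⟩
  refine ⟨c, hc1, hc2, fun d hd h1 => ?_⟩
  rw [sbtw_iff_pos_lt] at hc2
  rw [sbtw_iff_pos a] at h1
  have := hc3 d ⟨hd, by rw [sbtw_iff_pos_lt]; omega⟩
  omega

theorem exists_isNextEnd (hn : 3 ≤ n) (hD : IsHollowDissection D) {a b : ZMod (2 * n)}
    (h : IsEdge D a b) (hb : b ≠ a + 2) : ∃ b', IsNextEnd D a b b' := by
  obtain ⟨oa, ob, hab⟩ := h.odd hD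
  have hb2 : IsEdge D (b - 2) b := by
    have := isEdge_add_two (D := D) hn (a := b - 2) (ob.sub_even even_two)
    rwa [sub_add_cancel] at this
  have h1 : sbtw a (b - 2) b := by
    have h2 : b - 2 ≠ a := fun h => hb (by rw [← h]; ring)
    have := sbtw_or_sbtw hab h2 (hb2.odd hD).2.2
    rcases this with h | h
    · exact h
    -- Otherwise `a` lies strictly between `b - 2` and `b`, so it is the even point `b - 1`.
    · have h3 : a = b - 2 + 1 := eq_add_one_of_sbtw hn (a := b - 2) (by
        rw [sub_add_cancel]
        have h5 := pos_add_two hn (b - 2)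
        have h4 := (sbtw_iff_pos (b - 2)).1 h
        rw [sub_add_cancel] at h5
        rw [pos_self] at h4
        have h6 := (pos_injective (b - 2)).ne (ne_of_odd_of_even oa
          (((hb2.odd hD).1).add_odd odd_one))
        rw [pos_add_one hn] at h6
        have h7 := (pos_injective (b - 2)).ne h2
        rw [pos_self] at h7
        exact absurd h4 (by omega))
      exact absurd h3 (ne_of_odd_of_even oa (((hb2.odd hD).1).add_odd odd_one))
  obtain ⟨c, ⟨hc1, hc2⟩, hc3⟩ := Set.exists_min_image {c | IsEdge D c b ∧ sbtw a c b} (pos a)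
    (Set.toFinite _) ⟨b - 2, hb2, h1⟩
  refine ⟨c, hc1, hc2, fun d hd h1 => ?_⟩
  rw [sbtw_iff_pos_lt] at hc2 h1
  have := hc3 d ⟨hd, by rw [sbtw_iff_pos_lt]; omega⟩
  omega

theorem IsNextStart.unique {a b a' a'' : ZMod (2 * n)}
    (h : IsNextStart D a b a') (h' : IsNextStart D a b a'') : a' = a'' := by
  apply pos_injective a
  have h1 := h.max _ h'.edge
  have h2 := h'.max _ h.edge
  have h3 := h.sbtw
  have h4 := h'.sbtw
  simp only [sbtw_iff_pos a] at *
  rw [pos_self] at *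
  omega

theorem IsNextEnd.unique {a b b' b'' : ZMod (2 * n)}
    (h : IsNextEnd D a b b') (h' : IsNextEnd D a b b'') : b' = b'' := by
  apply pos_injective a
  have h1 := h.max _ h'.edge
  have h2 := h'.max _ h.edge
  have h3 := h.sbtw
  have h4 := h'.sbtw
  simp only [sbtw_iff_pos a] at *
  rw [pos_self] at *
  omega

/-- Around a cell, the two candidates for the next edge are in clockwise order. -/
theorem not_sbtw_next (hn : 3 ≤ n) (hD : IsHollowDissection D) {a b a' b' : ZMod (2 * n)}
    (ha : IsNextStart D a b a') (hb : IsNextEnd D a b b') : ¬ sbtw a b' a' := fun h => by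
  refine ha.edge.not_crosses hn hD hb.edge ⟨h, ?_⟩
  exact ha.sbtw.cyclic_left

/-- The arcs behind the two candidate next edges are disjoint, so the target decides which endpoint
is turned around. -/
theorem not_sbtw_of_sbtw_nextStart (hn : 3 ≤ n) (hD : IsHollowDissection D)
    {a b a' b' t : ZMod (2 * n)} (ha : IsNextStart D a b a') (hb : IsNextEnd D a b b')
    (h : sbtw a t a') : ¬ sbtw b' t b := by
  have h1 := not_sbtw_next hn hD ha hb
  have h3 := ha.sbtw
  have h4 := hb.sbtw
  simp only [sbtw_iff_pos a] at *
  rw [pos_self] at *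
  omega

theorem IsNextStart.sbtw_trans {a b a' t : ZMod (2 * n)} (ha : IsNextStart D a b a')
    (h : SBtw.sbtw a t a') : SBtw.sbtw a t b := by
  have h4 := ha.sbtw
  simp only [sbtw_iff_pos a] at *
  rw [pos_self] at *
  omega

theorem IsNextEnd.sbtw_trans {a b b' t : ZMod (2 * n)} (hb : IsNextEnd D a b b')
    (h : SBtw.sbtw b' t b) : SBtw.sbtw a t b := by
  have h4 := hb.sbtw
  simp only [sbtw_iff_pos a] at *
  rw [pos_self] at *
  omega

/-- Induction along the cells of `D`, starting from the boundary edges. -/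
theorem edge_induction (hn : 3 ≤ n) (hD : IsHollowDissection D)
    (C : ZMod (2 * n) → ZMod (2 * n) → Prop) (h0 : ∀ a, Odd a → C a (a + 2))
    (h1 : ∀ a b a' b', IsEdge D a b → IsNextStart D a b a' → IsNextEnd D a b b' →
      C a a' → C b' b → C a b) :
    ∀ a b, IsEdge D a b → C a b := by
  have key : ∀ (k : ℕ) (a b : ZMod (2 * n)), IsEdge D a b → pos a b = k → C a b := by
    intro k
    induction k using Nat.strong_induction_on with
    | _ k ih =>
      rintro a b hab rfl
      by_cases hb : b = a + 2
      · subst hb; exact h0 a (hab.odd hD).1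
      · obtain ⟨a', ha'⟩ := exists_isNextStart hn hD hab hb
        obtain ⟨b', hb'⟩ := exists_isNextEnd hn hD hab hb
        have h2 := ha'.sbtw
        have h3 := hb'.sbtw
        refine h1 a b a' b' hab ha' hb' (ih _ ?_ a a' ha'.edge rfl) (ih _ ?_ b' b hb'.edge rfl)
        · rw [sbtw_iff_pos_lt] at h2; exact h2.2
        · have h5 := (sbtw_iff_pos b').1 h3
          have h6 := pos_lt b' b
          have h7 : pos a b = if a.val ≤ b.val then _ else _ := pos_eq a b
          have h8 : pos b' b = if b'.val ≤ b.val then _ else _ := pos_eq b' b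
          have h9 := sbtw_iff_val.1 h3
          have h10 := ZMod.val_lt a
          have h11 := ZMod.val_lt b
          have h12 := ZMod.val_lt b'
          rw [h7, h8]
          split_ifs <;> omega
  exact fun a b hab => key _ a b hab rfl

end Edges

/-! ### Accordion diagonals as trajectories -/

section Accordions

variable {n : ℕ} {D : Set (Diag n)}

/-- `Reach D a b t`: having crossed the edge `ab`, one arrives at the solid vertex `t` by turning in
each cell around one of the two endpoints of the edge just crossed. -/
inductive Reach (D : Set (Diag n)) : ZMod (2 * n) → ZMod (2 * n) → ZMod (2 * n) → Prop
  | last {a b t : ZMod (2 * n)} (hb : b = a + 2) (ht : t = a + 1) : Reach D a b t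
  | turnStart {a b a' t : ZMod (2 * n)} (h : IsNextStart D a b a') (h' : Reach D a a' t) :
      Reach D a b t
  | turnEnd {a b b' t : ZMod (2 * n)} (h : IsNextEnd D a b b') (h' : Reach D b' b t) :
      Reach D a b t

theorem mem_cut {a b s t : ZMod (2 * n)} : s(a, b) ∈ cut D s(s, t) ↔
    IsEdge D a b ∧ ((sbtw a t b ∧ sbtw b s a) ∨ (sbtw a s b ∧ sbtw b t a)) := by
  rw [← crosses_iff]; rfl

theorem Reach.even (hD : IsHollowDissection D) {a b t : ZMod (2 * n)} (hab : IsEdge D a b)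
    (h : Reach D a b t) : Even t := by
  induction h with
  | last hb ht => subst ht; exact (hab.odd hD).1.add_odd odd_one
  | turnStart h _ ih => exact ih h.edge
  | turnEnd h _ ih => exact ih h.edge

variable [NeZero n]

theorem Reach.sbtw (hn : 3 ≤ n) {a b t : ZMod (2 * n)} (h : Reach D a b t) : sbtw a t b := by
  induction h with
  | last hb ht => subst hb ht; exact sbtw_add_one_add_two hn _
  | turnStart h _ ih => exact h.sbtw_trans ih
  | turnEnd h _ ih => exact h.sbtw_trans ih

theorem reach_add_two_iff (hn : 3 ≤ n) (hD : IsHollowDissection D) {a b t : ZMod (2 * n)}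
    (hab : IsEdge D a b) (hb : b = a + 2) : Reach D a b t ↔ t = a + 1 := by
  refine ⟨fun h => ?_, fun h => .last hb h⟩
  cases h with
  | last hb ht => exact ht
  | turnStart h _ => exact absurd hb (h.ne hn hD)
  | turnEnd h _ => exact absurd hb (h.ne hn hD hab)

theorem reach_iff (hn : 3 ≤ n) (hD : IsHollowDissection D) {a b a' b' t : ZMod (2 * n)}
    (ha : IsNextStart D a b a') (hb : IsNextEnd D a b b') :
    Reach D a b t ↔ Reach D a a' t ∨ Reach D b' b t := by
  constructor
  · intro h
    cases h with
    | last h _ => exact absurd h (ha.ne hn hD)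
    | turnStart h h' => exact Or.inl (ha.unique h ▸ h')
    | turnEnd h h' => exact Or.inr (hb.unique h ▸ h')
  · rintro (h | h)
    · exact .turnStart ha h
    · exact .turnEnd hb h

theorem isEdge_around_even (hn : 3 ≤ n) {t : ZMod (2 * n)} (ht : Even t) :
    IsEdge D (t - 1) (t + 1) := by
  have := isEdge_add_two (D := D) hn (ht.sub_odd odd_one)
  rwa [show t - 1 + 2 = t + 1 by ring] at this

theorem sbtw_around (hn : 3 ≤ n) (t : ZMod (2 * n)) : sbtw (t - 1) t (t + 1) := by
  have := sbtw_add_one_add_two hn (t - 1)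
  rwa [sub_add_cancel, show t - 1 + 2 = t + 1 by ring] at this

theorem sbtw_around' (hn : 3 ≤ n) {s t : ZMod (2 * n)} (hs : Even s) (ht : Even t)
    (hst : s ≠ t) : sbtw (t + 1) s (t - 1) := by
  have h1 := not_sbtw_add_one hn t s
  have h2 := not_sbtw_add_one hn (t - 1) s
  have h3 := sbtw_around hn t
  have h4 := (pos_injective t).ne hst
  have h5 := (pos_injective t).ne (ne_of_odd_of_even (ht.sub_odd odd_one) hs)
  have h6 := (pos_injective t).ne (ne_of_odd_of_even (ht.add_odd odd_one) hs)
  rw [sub_add_cancel] at h2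
  simp only [sbtw_iff_pos t, pos_self] at *
  omega

/-- If the diagonal left the cell between `a'` and `b'`, no chain in its cut could pass from `ab` to
the edges beyond: the cut would be disconnected. -/
theorem IsAccordionDiag.turn (hn : 3 ≤ n) (hD : IsHollowDissection D)
    {s t a b a' b' : ZMod (2 * n)} (h : IsAccordionDiag D s(s, t)) (hs : Even s) (ht : Even t)
    (hab : IsEdge D a b) (h1 : sbtw a t b) (h2 : sbtw b s a)
    (ha : IsNextStart D a b a') (hb : IsNextEnd D a b b') : sbtw a t a' ∨ sbtw b' t b := by
  by_contra! hcon
  obtain ⟨hc1, hc2⟩ := hcon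
  have hta' : pos a a' ≠ pos a t := (pos_injective a).ne (ne_of_odd_of_even (ha.edge.odd hD).2.1 ht)
  have htb' : pos a b' ≠ pos a t := (pos_injective a).ne (ne_of_odd_of_even (hb.edge.odd hD).1 ht)
  have haa := ha.sbtw
  have hbb := hb.sbtw
  -- Invariant of a chain starting at `ab`: it stays weakly on the side of `s`. An edge at `a` or
  -- `b` leading to the other side stops at `a'` or `b'` at the latest, and so is not crossed.
  have key : ∀ f, Relation.ReflTransGen (fun x y => y ∈ cut D s(s, t) ∧ ∃ v, v ∈ x ∧ v ∈ y)
      s(a, b) f → ∃ u v, f = s(u, v) ∧ (u = a ∨ pos a s < pos a u) ∧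
        (v = b ∨ pos a b < pos a v ∧ pos a v < pos a s) := by
    rw [sbtw_iff_pos_lt] at h1 hc1 haa hbb
    rw [sbtw_iff_lt_pos] at h2
    rw [sbtw_iff_of_lt hbb.2] at hc2
    replace hc1 : pos a a' < pos a t := by omega
    replace hc2 : pos a t < pos a b' := by omega
    intro f hf
    induction hf with
    | refl => exact ⟨a, b, rfl, Or.inl rfl, Or.inl rfl⟩
    | @tail e f _ hef ih =>
      obtain ⟨u, v, rfl, hu, hv⟩ := ih
      obtain ⟨hf, w, hw1, hw2⟩ := hef
      have : ∃ x y, f = s(x, y) ∧ IsEdge D x y ∧ sbtw x t y ∧ sbtw y s x := by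
        induction f using Sym2.ind with
        | _ x y =>
          rcases mem_cut.1 hf with ⟨h1, h2 | h2⟩
          · exact ⟨x, y, rfl, h1, h2⟩
          · exact ⟨y, x, Sym2.eq_swap, h1.symm, h2.2, h2.1⟩
      obtain ⟨x, y, rfl, hxy, hx, hy⟩ := this
      refine ⟨x, y, rfl, ?_⟩
      have hnc := hab.not_crosses hn hD hxy.symm
      have hnc' := hab.not_crosses hn hD hxy
      rw [sbtw_iff_pos_lt, sbtw_iff_lt_pos (a := a)] at hnc hnc'
      have hx' : pos a x < pos a t ∨ pos a s < pos a x := by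
        rw [sbtw_iff_pos a] at hx hy
        clear hnc; omega
      have hy' : pos a t < pos a y ∧ pos a y < pos a s := by
        rw [sbtw_iff_pos a] at hx hy
        clear hnc; omega
      clear hx hy
      have hw : u = x ∨ v = y ∨ u = y ∨ v = x := by
        rw [Sym2.mem_iff] at hw1 hw2
        rcases hw1 with h1 | h1 <;> rcases hw2 with h2 | h2
        · exact Or.inl (h1.symm.trans h2)
        · exact Or.inr (Or.inr (Or.inl (h1.symm.trans h2)))
        · exact Or.inr (Or.inr (Or.inr (h1.symm.trans h2)))
        · exact Or.inr (Or.inl (h1.symm.trans h2))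
      rcases hw with rfl | rfl | rfl | rfl
      · refine ⟨hu, or_iff_not_imp_left.2 fun hya => ?_⟩
        have hyb := (pos_injective a).ne hya
        rcases hu with rfl | hu
        · have hm := ha.max y hxy
          rw [sbtw_iff_of_lt haa.2] at hm
          omega
        · omega
      · refine ⟨or_iff_not_imp_left.2 fun hxa => ?_, hv⟩
        have hxb := (pos_injective a).ne hxa
        rw [pos_self] at hxb
        rcases hv with rfl | hv
        · have hm := hb.max x hxy
          rw [sbtw_iff_pos_lt] at hm
          omega
        · omega
      · exfalso
        rcases hu with rfl | hu
        · rw [pos_self] at *; omega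
        · omega
      · exfalso
        rcases hv with rfl | hv <;> omega
  have hst : s ≠ t := by
    rintro rfl
    simp only [sbtw_iff_pos a, pos_self] at *
    omega
  -- The boundary edge around `t` belongs to the cut but violates the invariant, since `ab` is not
  -- that edge.
  have hlast : s(t - 1, t + 1) ∈ cut D s(s, t) :=
    mem_cut.2 ⟨isEdge_around_even hn ht, Or.inl ⟨sbtw_around hn t, sbtw_around' hn hs ht hst⟩⟩
  have hfirst : s(a, b) ∈ cut D s(s, t) := mem_cut.2 ⟨hab, Or.inl ⟨h1, h2⟩⟩
  obtain ⟨u, v, huv, hu, hv⟩ := key _ (h.2 _ hfirst _ hlast)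
  have n1 := not_sbtw_add_one hn (t - 1) a
  have n2 := not_sbtw_add_one hn t b
  have n3 := sbtw_around hn t
  have n4 := sbtw_around' hn hs ht hst
  rw [sub_add_cancel] at n1
  simp only [sbtw_iff_pos a, pos_self] at n1 n2 n3 n4 h1 h2
  rcases Sym2.eq_iff.1 huv with ⟨h3, h4⟩ | ⟨h3, h4⟩
  · rw [← h3] at hu
    rw [← h4] at hv
    rcases hu with hu | hu <;> rcases hv with hv | hv
    · exact ha.ne hn hD (by rw [← hu, ← hv]; ring)
    · have : pos a (t - 1) = 0 := by rw [hu, pos_self]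
      omega
    · rw [hv] at *; omega
    · omega
  · rw [← h3] at hv
    rw [← h4] at hu
    rcases hu with hu | hu
    · have : pos a (t + 1) = 0 := by rw [hu, pos_self]
      rcases hv with hv | hv
      · rw [hv] at *; omega
      · omega
    · rcases hv with hv | hv
      · rw [hv] at *; omega
      · omega

/-- An accordion diagonal, after each edge it crosses, turns in every cell around an endpoint of the
edge just crossed. -/
theorem IsAccordionDiag.reach (hn : 3 ≤ n) (hD : IsHollowDissection D)
    {s t : ZMod (2 * n)} (h : IsAccordionDiag D s(s, t)) (hs : Even s) (ht : Even t) :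
    ∀ a b, IsEdge D a b → sbtw a t b → sbtw b s a → Reach D a b t := by
  apply edge_induction hn hD (fun a b => sbtw a t b → sbtw b s a → Reach D a b t)
  · intro a ha h1 h2
    exact .last rfl (eq_add_one_of_sbtw hn h1)
  · intro a b a' b' hab ha hb iha ihb h1 h2
    have h3 := ha.sbtw
    have h4 := hb.sbtw
    rcases h.turn hn hD hs ht hab h1 h2 ha hb with h5 | h5
    · refine .turnStart ha (iha h5 ?_)
      simp only [sbtw_iff_pos a, pos_self] at *
      omega
    · refine .turnEnd hb (ihb h5 ?_)
      simp only [sbtw_iff_pos a, pos_self] at *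
      omega

end Accordions

/-! ### Trajectories are accordion diagonals -/

section Accordions

variable {n : ℕ} {D : Set (Diag n)}

/-- Two members of a set of diagonals sharing an endpoint. -/
def Touch (A : Set (Diag n)) (e f : Diag n) : Prop := e ∈ A ∧ f ∈ A ∧ ∃ v, v ∈ e ∧ v ∈ f

variable [NeZero n]

/-- An edge separating `t` weakly beyond `ab` is either `ab` itself or lies weakly beyond the next
edge of the trajectory. In the second case induction links it to that edge, which shares the turning
vertex with `ab`. -/
theorem Reach.connected (hn : 3 ≤ n) (hD : IsHollowDissection D) {a b t : ZMod (2 * n)}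
    (hab : IsEdge D a b) (h : Reach D a b t) : ∀ s u v : ZMod (2 * n), SBtw.sbtw b s a →
      IsEdge D u v → (u = a ∨ SBtw.sbtw a u t) → (v = b ∨ SBtw.sbtw t v b) →
      Relation.ReflTransGen (Touch (cut D s(s, t))) s(u, v) s(a, b) := by
  induction h with
  | @last a b t hb ht =>
    subst hb ht
    intro s u v _ _ hu hv
    have h1 := hu.resolve_right (not_sbtw_add_one hn _ _)
    have h2 := hv.resolve_right (by
      rw [show a + 2 = a + 1 + 1 by ring]; exact not_sbtw_add_one hn _ _)
    rw [h1, h2]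
  | @turnStart a b a' t ha h ih =>
    intro s u v hs huv hu hv
    have h1 := h.sbtw hn
    have h2 := ha.sbtw
    have h3 : SBtw.sbtw a' s a := by
      rw [sbtw_iff_pos a] at *; rw [pos_self] at *; omega
    have hta : t ≠ a' := (sbtw_ne h1).2.1
    by_cases hc : v = a' ∨ SBtw.sbtw t v a'
    · refine (ih ha.edge s u v h3 huv hu hc).tail ⟨?_, ?_, a, by simp, by simp⟩
      · exact mem_cut.2 ⟨ha.edge, Or.inl ⟨h1, h3⟩⟩
      · exact mem_cut.2 ⟨hab, Or.inl ⟨ha.sbtw_trans h1, hs⟩⟩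
    · push Not at hc
      have hva := (pos_injective a).ne hc.1
      have hc2 := hc.2
      have h4 : pos a a' < pos a v ∧ pos a v ≤ pos a b := by
        rw [sbtw_iff_pos_lt] at h1 h2
        rw [sbtw_iff_of_lt h1.2] at hc2
        rcases hv with rfl | hv
        · exact ⟨h2.2, le_rfl⟩
        · rw [sbtw_iff_of_lt (o := a) (by omega)] at hv
          omega
      have hua : u = a := by
        refine hu.resolve_right fun hu => ha.edge.not_crosses hn hD huv ⟨?_, ?_⟩
        · rw [sbtw_iff_pos_lt] at *; omega
        · rw [sbtw_iff_pos_lt] at h2; rw [sbtw_iff_lt_pos (a := a)]; omega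
      subst hua
      have := ha.max v huv
      rw [sbtw_iff_pos_lt] at h2
      rw [sbtw_iff_of_lt h2.2] at this
      rw [pos_injective u (show pos u v = pos u b by omega)]
  | @turnEnd a b b' t hb h ih =>
    intro s u v hs huv hu hv
    have h1 := h.sbtw hn
    have h2 := hb.sbtw
    have h3 : SBtw.sbtw b s b' := by
      rw [sbtw_iff_pos a] at *; rw [pos_self] at *; omega
    have hta : t ≠ b' := (sbtw_ne h1).1.symm
    by_cases hc : u = b' ∨ SBtw.sbtw b' u t
    · refine (ih hb.edge s u v h3 huv hc hv).tail ⟨?_, ?_, b, by simp, by simp⟩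
      · exact mem_cut.2 ⟨hb.edge, Or.inl ⟨h1, h3⟩⟩
      · exact mem_cut.2 ⟨hab, Or.inl ⟨hb.sbtw_trans h1, hs⟩⟩
    · push Not at hc
      have hva := (pos_injective a).ne hc.1
      have hc2 := hc.2
      rw [sbtw_iff_pos_lt] at h2
      rw [sbtw_iff_of_lt h2.2] at h1
      rw [sbtw_iff_of_lt h1.1] at hc2
      have h4 : pos a u < pos a b' := by
        rcases hu with rfl | hu
        · rw [pos_self]; omega
        · rw [sbtw_iff_pos_lt] at hu
          omega
      have hvb : v = b := by
        refine hv.resolve_right fun hv => hb.edge.not_crosses hn hD huv.symm ⟨?_, ?_⟩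
        · rw [sbtw_iff_of_lt h1.2] at hv; rw [sbtw_iff_of_lt h2.2]; omega
        · rw [sbtw_iff_pos a]; omega
      subst hvb
      have := hb.max u huv
      rw [sbtw_iff_pos_lt] at this
      have hu0 : pos a u = pos a a := by rw [pos_self]; omega
      rw [pos_injective a hu0]

theorem isAccordionDiag_of_reach (hn : 3 ≤ n) (hD : IsHollowDissection D)
    {a b s t : ZMod (2 * n)} (hab : IsEdge D a b) (h1 : Reach D a b t) (h2 : Reach D b a s) :
    IsAccordionDiag D s(s, t) := by
  have b1 := h1.sbtw hn
  have b2 := h2.sbtw hn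
  have es := h2.even hD hab.symm
  have et := h1.even hD hab
  have hst : s ≠ t := by
    rintro rfl
    rw [sbtw_iff_pos a] at b1 b2; rw [pos_self] at *; omega
  refine ⟨⟨s, t, es, et, hst, rfl⟩, ?_⟩
  have key : ∀ e ∈ cut D s(s, t), Relation.ReflTransGen (Touch (cut D s(s, t))) e s(a, b) := by
    intro e he
    have : ∃ x y, e = s(x, y) ∧ IsEdge D x y ∧ sbtw x t y ∧ sbtw y s x := by
      induction e using Sym2.ind with
      | _ x y =>
        rcases mem_cut.1 he with ⟨h1, h2 | h2⟩
        · exact ⟨x, y, rfl, h1, h2⟩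
        · exact ⟨y, x, Sym2.eq_swap, h1.symm, h2.2, h2.1⟩
    obtain ⟨x, y, rfl, hxy, hx, hy⟩ := this
    have hnc := hab.not_crosses hn hD hxy
    have hnc' := hab.not_crosses hn hD hxy.symm
    -- By non-crossing, a crossed edge lies weakly on the `t` side or weakly on the `s` side of
    -- `ab`, so one of the two trajectories links it to `ab`.
    by_cases hf : (x = a ∨ sbtw a x t) ∧ (y = b ∨ sbtw t y b)
    · exact h1.connected hn hD hab s x y b2 hxy hf.1 hf.2
    · have hf' : (y = b ∨ sbtw b y s) ∧ (x = a ∨ sbtw s x a) := by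
        have exa : x = a ∨ pos a x ≠ 0 := by
          rcases eq_or_ne x a with h | h
          · exact Or.inl h
          · have := (pos_injective a).ne h
            rw [pos_self] at this; exact Or.inr this
        have eyb : y = b ∨ pos a y ≠ pos a b := by
          rcases eq_or_ne y b with h | h
          · exact Or.inl h
          · exact Or.inr ((pos_injective a).ne h)
        rw [sbtw_iff_pos_lt] at b1
        rw [sbtw_iff_lt_pos (a := a)] at b2
        rw [sbtw_iff_pos_lt, sbtw_iff_lt_pos (a := a)] at hnc hnc'
        rw [sbtw_iff_of_lt b1.2, sbtw_iff_pos_lt] at hf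
        rw [sbtw_iff_of_lt b2.2, sbtw_iff_lt_pos (a := a)]
        have hx' : pos a x < pos a t ∨ pos a s < pos a x := by
          rw [sbtw_iff_pos a] at hx hy
          clear hnc hnc' exa eyb hf; omega
        have hy' : pos a t < pos a y ∧ pos a y < pos a s := by
          rw [sbtw_iff_pos a] at hx hy
          clear hnc hnc' exa eyb hf; omega
        clear hx hy
        rcases exa with rfl | exa
        · simp only [true_or, true_and, and_true] at hf ⊢
          push Not at hf
          refine or_iff_not_imp_left.2 fun h => ?_
          have := (pos_injective x).ne h
          omega
        · rcases eyb with rfl | eyb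
          · simp only [true_or, true_and, and_true] at hf ⊢
            push Not at hf
            refine or_iff_not_imp_left.2 fun h => ?_
            have := (pos_injective a).ne h
            rw [pos_self] at this
            omega
          · constructor <;> right <;> by_contra h <;> apply hf <;> constructor <;> right <;> omega
      have := h2.connected hn hD hab.symm t y x b1 hxy.symm hf'.1 hf'.2
      rwa [Sym2.eq_swap (a := y), Sym2.eq_swap (a := b), Sym2.eq_swap (a := t)] at this
  intro e he f hf
  have hsymm : Std.Symm (Touch (cut D s(s, t))) :=
    ⟨fun x y ⟨h1, h2, v, h3, h4⟩ => ⟨h2, h1, v, h4, h3⟩⟩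
  have hmono := Relation.ReflTransGen.mono (r := Touch (cut D s(s, t)))
    (p := fun x y => y ∈ cut D s(s, t) ∧ ∃ v, v ∈ x ∧ v ∈ y) fun x y h => h.2
  exact hmono _ _ ((key e he).trans (Relation.ReflTransGen.stdSymm.symm _ _ (key f hf)))

end Accordions

/-! ### Signs in terms of turns -/

section Signs

variable {n : ℕ} {D : Set (Diag n)}

/-- Towards `t`, one turns around the start of the edge `ab` after crossing it. -/
def TurnsStart (D : Set (Diag n)) (a b t : ZMod (2 * n)) : Prop :=
  ∃ a', IsNextStart D a b a' ∧ sbtw a t a'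

/-- Towards `t`, one turns around the end of the edge `ab` after crossing it. -/
def TurnsEnd (D : Set (Diag n)) (a b t : ZMod (2 * n)) : Prop :=
  ∃ b', IsNextEnd D a b b' ∧ sbtw b' t b

theorem IsNextCrossed.symm {δ e f : Diag n} (h : IsNextCrossed D δ e f) :
    IsNextCrossed D δ f e := by
  obtain ⟨h1, h2, h3, C, h4, h5, h6⟩ := h
  exact ⟨h2, h1, h3.symm, C, h4, h6, h5⟩

theorem FormsZ.crosses {e δ : Diag n} (h : FormsZ D e δ) : Crosses e δ := by
  obtain ⟨_, _, _, _, _, _, _, h, _⟩ := h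
  exact h.1.2

theorem FormsS.crosses {e δ : Diag n} (h : FormsS D e δ) : Crosses e δ := by
  obtain ⟨_, _, _, _, _, _, _, h, _⟩ := h
  exact h.1.2

variable [NeZero n]

theorem TurnsStart.sbtw {a b t : ZMod (2 * n)} (h : TurnsStart D a b t) : SBtw.sbtw a t b := by
  obtain ⟨a', h1, h2⟩ := h
  exact h1.sbtw_trans h2

theorem TurnsEnd.sbtw {a b t : ZMod (2 * n)} (h : TurnsEnd D a b t) : SBtw.sbtw a t b := by
  obtain ⟨a', h1, h2⟩ := h
  exact h1.sbtw_trans h2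

/-- An edge separating `a` from `b'` would cross `ab` or `b'b`, unless it ends at `b`; then it would
come before `b'` around `b`. Hence `a`, `b`, `b'` lie in one cell. -/
theorem IsNextEnd.not_crosses (hn : 3 ≤ n) (hD : IsHollowDissection D) {a b b' x y : ZMod (2 * n)}
    (hab : IsEdge D a b) (hb : IsNextEnd D a b b') (hxy : IsEdge D x y) :
    ¬ Crosses s(x, y) s(a, b') := by
  have key : ∀ {x y : ZMod (2 * n)}, IsEdge D x y → SBtw.sbtw x a y → SBtw.sbtw y b' x →
      False := by
    intro x y hxy h1 h2
    have h3 := hb.sbtw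
    have h4 := hab.not_crosses hn hD hxy.symm
    have h5 := hb.edge.not_crosses hn hD hxy
    have h6 : x = b → False := by
      rintro rfl
      have := hb.max y hxy.symm
      simp only [sbtw_iff_pos a, pos_self] at *
      omega
    have h6 := (pos_injective a).ne h6
    simp only [sbtw_iff_pos a, pos_self] at *
    omega
  rw [crosses_iff]
  rintro (⟨h1, h2⟩ | ⟨h1, h2⟩)
  · exact key hxy.symm h2 h1
  · exact key hxy h1 h2

theorem IsNextEnd.exists_cell (hn : 3 ≤ n) (hD : IsHollowDissection D) {a b b' : ZMod (2 * n)}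
    (hab : IsEdge D a b) (hb : IsNextEnd D a b b') : ∃ C, IsCell D C ∧ a ∈ C ∧ b ∈ C ∧ b' ∈ C := by
  obtain ⟨oa, ob, -⟩ := hab.odd hD
  obtain ⟨ob', -, -⟩ := hb.edge.odd hD
  have hfin : {C : Set (ZMod (2 * n)) |
    (∀ v ∈ C, Odd v) ∧ ∀ u ∈ C, ∀ v ∈ C, ∀ e ∈ D, ¬ Crosses e s(u, v)}.Finite := Set.toFinite _
  obtain ⟨C, hC1, hC2⟩ := hfin.exists_le_maximal (a := {a, b, b'}) (by
    constructor
    · rintro v (rfl | rfl | rfl) <;> assumption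
    · intro u hu v hv e he
      induction e using Sym2.ind with
      | _ x y =>
        have hxy : IsEdge D x y := Or.inl he
        have hrefl : ∀ u, ¬ Crosses s(x, y) s(u, u) := by
          intro u
          rw [crosses_iff]
          have h0 := pos_self u
          rw [sbtw_iff_pos u, sbtw_iff_pos u]
          omega
        have h1 : ∀ {u v}, IsEdge D u v → ¬ Crosses s(x, y) s(u, v) := by
          intro u v huv
          rw [crosses_iff]
          have h2 := hxy.not_crosses hn hD huv
          have h3 := hxy.not_crosses hn hD huv.symm
          tauto
        have h2 := hb.not_crosses hn hD hab hxy
        have h3 : ¬ Crosses s(x, y) s(b', a) := by rwa [Sym2.eq_swap (a := b')]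
        rcases hu with rfl | rfl | rfl <;> rcases hv with rfl | rfl | rfl
        exacts [hrefl _, h1 hab, h2, h1 hab.symm, hrefl _, h1 hb.edge.symm, h3, h1 hb.edge, hrefl _])
  exact ⟨C, hC2, hC1 (by simp), hC1 (by simp), hC1 (by simp)⟩

/-- An edge `cb` lying between the two would separate `a` from `d` inside the cell. -/
theorem isNextEnd_of_cell (hn : 3 ≤ n) (hD : IsHollowDissection D) {a b d : ZMod (2 * n)}
    {C : Set (ZMod (2 * n))} (hab : IsEdge D a b) (hd : IsEdge D d b) (h : sbtw a d b)
    (hC : IsCell D C) (h1 : a ∈ C) (h2 : d ∈ C) : IsNextEnd D a b d := by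
  refine ⟨hd, h, fun c hc h' => ?_⟩
  obtain ⟨oc, ob, -⟩ := hc.odd hD
  have oa := (hab.odd hD).1
  have od := (hd.odd hD).1
  rw [sbtw_iff_pos_lt] at h h'
  refine hC.1.2 a h1 d h2 s(c, b) (mem_of_isEdge hc ?_ ?_) ?_
  · rintro rfl
    exact ne_of_odd_of_even od (oc.add_odd odd_one) (eq_add_one_of_sbtw hn
      (by rw [sbtw_iff_of_lt (o := a)] <;> omega))
  · rintro rfl
    refine ne_of_odd_of_even oa (ob.add_odd odd_one) (eq_add_one_of_sbtw hn ?_)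
    rw [sbtw_iff_pos a, pos_self]; omega
  · rw [crosses_iff, sbtw_iff_of_lt (o := a) (by omega), sbtw_iff_lt_pos (a := c),
      sbtw_iff_pos a, pos_self]
    left
    refine ⟨by omega, ?_⟩
    have : sbtw b a c := by rw [sbtw_iff_pos a, pos_self]; omega
    rwa [sbtw_iff_lt_pos (a := c)] at this

theorem isNextCrossed_of_isNextEnd (hn : 3 ≤ n) (hD : IsHollowDissection D)
    {a b b' : ZMod (2 * n)} {δ : Diag n} (hab : IsEdge D a b) (hb : IsNextEnd D a b b')
    (h1 : Crosses s(a, b) δ) (h2 : Crosses s(b', b) δ) :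
    IsNextCrossed D δ s(a, b) s(b', b) := by
  obtain ⟨C, hC, ha', hb', hb''⟩ := hb.exists_cell hn hD hab
  refine ⟨⟨hab, h1⟩, ⟨hb.edge, h2⟩, ?_, C, hC, ?_, ?_⟩
  · intro h
    have h3 := sbtw_ne hb.sbtw
    rcases Sym2.eq_iff.1 h with ⟨h, -⟩ | ⟨h, -⟩
    · exact h3.1 h.symm
    · exact h3.2.1 h
  · intro v hv
    rcases Sym2.mem_iff.1 hv with rfl | rfl <;> assumption
  · intro v hv
    rcases Sym2.mem_iff.1 hv with rfl | rfl <;> assumption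

theorem IsNextCrossed.isNextEnd (hn : 3 ≤ n) (hD : IsHollowDissection D)
    {a b d : ZMod (2 * n)} {δ : Diag n} (h : IsNextCrossed D δ s(a, b) s(d, b))
    (hd : sbtw a d b) : IsNextEnd D a b d := by
  obtain ⟨h1, h2, -, C, hC, h4, h5⟩ := h
  exact isNextEnd_of_cell hn hD h1.1 h2.1 hd hC (h4 _ (by simp)) (h5 _ (by simp))

theorem sbtw_of_crosses {a b s t d : ZMod (2 * n)} (h2 : sbtw b s a)
    (hd : sbtw a d b) (h : Crosses s(d, b) s(s, t)) : sbtw d t b := by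
  rcases crosses_iff.1 h with h | h
  · exact h.1
  · exfalso
    have h3 := h.1
    rw [sbtw_iff_pos_lt] at hd
    rw [sbtw_iff_lt_pos (a := a)] at h2
    rw [sbtw_iff_of_lt hd.2] at h3
    omega

theorem sbtw_of_crosses_start {a b s t d : ZMod (2 * n)} (h2 : sbtw b s a)
    (hd : sbtw a d b) (h : Crosses s(a, d) s(s, t)) : sbtw a t d := by
  rcases crosses_iff.1 h with h | h
  · exact h.1
  · exfalso
    have h3 := h.1
    rw [sbtw_iff_pos_lt] at hd h3
    rw [sbtw_iff_lt_pos (a := a)] at h2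
    omega

/-- In a `Z` the neighbouring edges hang on opposite endpoints: `b` towards `t`, and `a` towards
`s`. Each is the end of the edge directed for that crossing. -/
theorem formsZ_iff (hn : 3 ≤ n) (hD : IsHollowDissection D) {a b s t : ZMod (2 * n)}
    (hab : IsEdge D a b) (h1 : sbtw a t b) (h2 : sbtw b s a) :
    FormsZ D s(a, b) s(s, t) ↔ TurnsEnd D a b t ∧ TurnsEnd D b a s := by
  constructor
  · rintro ⟨c, b0, a0, d, he, h3, h4, h5, h6⟩
    have g1 : IsNextEnd D a0 b0 c := by
      rw [he, Sym2.eq_swap (a := b0)] at h5; exact h5.isNextEnd hn hD h3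
    have g2 : IsNextEnd D b0 a0 d := by
      rw [he, Sym2.eq_swap (a := a0)] at h6; exact h6.isNextEnd hn hD h4
    have c1 := h5.2.1.2
    have c2 := h6.2.1.2
    rw [Sym2.eq_swap] at c2
    rcases Sym2.eq_iff.1 he with ⟨rfl, rfl⟩ | ⟨rfl, rfl⟩
    · refine ⟨⟨d, g2, sbtw_of_crosses h2 h4 c2⟩, ⟨c, g1, sbtw_of_crosses h1 h3 ?_⟩⟩
      rwa [Sym2.eq_swap (a := t)]
    · refine ⟨⟨c, g1, sbtw_of_crosses h2 h3 c1⟩, ⟨d, g2, sbtw_of_crosses h1 h4 ?_⟩⟩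
      rwa [Sym2.eq_swap (a := t)]
  · rintro ⟨⟨b', hb, h3⟩, ⟨a', ha, h4⟩⟩
    refine ⟨a', a, b, b', rfl, ha.sbtw, hb.sbtw, ?_, ?_⟩
    · rw [Sym2.eq_swap (a := a)]
      refine isNextCrossed_of_isNextEnd hn hD hab.symm ha ?_ ?_
      · exact crosses_iff.2 (Or.inr ⟨h2, h1⟩)
      · refine crosses_iff.2 (Or.inr ⟨h4, ?_⟩)
        have := ha.sbtw
        simp only [sbtw_iff_pos a, pos_self] at *
        omega
    · rw [Sym2.eq_swap (a := b)]
      refine isNextCrossed_of_isNextEnd hn hD hab hb ?_ ?_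
      · exact crosses_iff.2 (Or.inl ⟨h1, h2⟩)
      · refine crosses_iff.2 (Or.inl ⟨h3, ?_⟩)
        have := hb.sbtw
        simp only [sbtw_iff_pos a, pos_self] at *
        omega

theorem formsS_iff (hn : 3 ≤ n) (hD : IsHollowDissection D) {a b s t : ZMod (2 * n)}
    (hab : IsEdge D a b) (h1 : sbtw a t b) (h2 : sbtw b s a) :
    FormsS D s(a, b) s(s, t) ↔ TurnsStart D a b t ∧ TurnsStart D b a s := by
  constructor
  · rintro ⟨c, b0, a0, d, he, h3, h4, h5, h6⟩
    have hab' := hab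
    unfold IsEdge at hab'
    rw [he] at hab'
    have g1 : IsNextStart D b0 a0 c := by
      rw [he, Sym2.eq_swap (a := b0)] at h5
      have := h5.symm.isNextEnd hn hD h3.cyclic_left
      exact this.flip h5.2.1.1
    have g2 : IsNextStart D a0 b0 d := by
      rw [he, Sym2.eq_swap (a := a0) (b := d)] at h6
      have := h6.symm.isNextEnd hn hD h4.cyclic_left
      exact this.flip h6.2.1.1
    have c1 := h5.2.1.2
    have c2 := h6.2.1.2
    rw [Sym2.eq_swap] at c1
    rcases Sym2.eq_iff.1 he with ⟨rfl, rfl⟩ | ⟨rfl, rfl⟩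
    · refine ⟨⟨c, g1, sbtw_of_crosses_start h2 h3 c1⟩, ⟨d, g2, sbtw_of_crosses_start h1 h4 ?_⟩⟩
      rwa [Sym2.eq_swap (a := t)]
    · refine ⟨⟨d, g2, sbtw_of_crosses_start h2 h4 c2⟩, ⟨c, g1, sbtw_of_crosses_start h1 h3 ?_⟩⟩
      rwa [Sym2.eq_swap (a := t)]
  · rintro ⟨⟨a', ha, h3⟩, ⟨b', hb, h4⟩⟩
    refine ⟨a', a, b, b', rfl, ha.sbtw, hb.sbtw, ?_, ?_⟩
    · rw [Sym2.eq_swap (a := a') (b := a)]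
      have := isNextCrossed_of_isNextEnd hn hD (δ := s(s, t)) ha.edge.symm (ha.flip hab) ?_ ?_
      · have := this.symm
        rwa [Sym2.eq_swap (a := b), Sym2.eq_swap (a := a')] at this
      · refine crosses_iff.2 (Or.inr ⟨?_, h3⟩)
        have := ha.sbtw
        simp only [sbtw_iff_pos a, pos_self] at *
        omega
      · exact crosses_iff.2 (Or.inr ⟨h2, h1⟩)
    · have := isNextCrossed_of_isNextEnd hn hD (δ := s(s, t)) hb.edge.symm (hb.flip hab.symm) ?_ ?_
      · have := this.symm
        rwa [Sym2.eq_swap (a := b')] at this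
      · refine crosses_iff.2 (Or.inl ⟨?_, h4⟩)
        have := hb.sbtw
        simp only [sbtw_iff_pos a, pos_self] at *
        omega
      · exact crosses_iff.2 (Or.inl ⟨h1, h2⟩)

theorem not_turnsStart_and_turnsEnd (hn : 3 ≤ n) (hD : IsHollowDissection D)
    {a b t : ZMod (2 * n)} : ¬ (TurnsStart D a b t ∧ TurnsEnd D a b t) := by
  rintro ⟨⟨a', ha, h1⟩, ⟨b', hb, h2⟩⟩
  exact not_sbtw_of_sbtw_nextStart hn hD ha hb h1 h2

theorem Reach.turns (hn : 3 ≤ n) {a b t : ZMod (2 * n)} (h : Reach D a b t) (hb : b ≠ a + 2) :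
    TurnsStart D a b t ∨ TurnsEnd D a b t := by
  cases h with
  | last h _ => exact absurd h hb
  | turnStart ha h => exact Or.inl ⟨_, ha, h.sbtw hn⟩
  | turnEnd ha h => exact Or.inr ⟨_, ha, h.sbtw hn⟩

end Signs

/-! ### Leaves of the lamination with given shear coordinates -/

section Leaves

open MeasureTheory

variable {n : ℕ} {D : Set (Diag n)} {x : Diag n → ℝ}

/-- `Leaf D x a b p t`: the leaf crossing the edge `ab` and entering the next cell at signed
distance `p` from its centre ends at `t`.  It turns around the start of `ab` if `p < 0` and around
its end if `p > 0`, and is shifted by `x e` when crossing the edge `e`. -/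
inductive Leaf (D : Set (Diag n)) (x : Diag n → ℝ) :
    ZMod (2 * n) → ZMod (2 * n) → ℝ → ZMod (2 * n) → Prop
  | last {a b t : ZMod (2 * n)} {p : ℝ} (hb : b = a + 2) (ht : t = a + 1) : Leaf D x a b p t
  | turnStart {a b a' t : ZMod (2 * n)} {p : ℝ} (h : IsNextStart D a b a') (hp : p < 0)
      (h' : Leaf D x a a' (p + x s(a, a')) t) : Leaf D x a b p t
  | turnEnd {a b b' t : ZMod (2 * n)} {p : ℝ} (h : IsNextEnd D a b b') (hp : 0 < p)
      (h' : Leaf D x b' b (p + x s(b', b)) t) : Leaf D x a b p t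

/-- The positions along the edge `ab` of the leaves from `s` to `t`. -/
def leafSet (D : Set (Diag n)) (x : Diag n → ℝ) (a b s t : ZMod (2 * n)) : Set ℝ :=
  {p | Leaf D x a b (p + x s(a, b)) t ∧ Leaf D x b a (-p) s}

theorem Leaf.reach {a b t : ZMod (2 * n)} {p : ℝ} (h : Leaf D x a b p t) : Reach D a b t := by
  induction h with
  | last hb ht => exact .last hb ht
  | turnStart h _ _ ih => exact .turnStart h ih
  | turnEnd h _ _ ih => exact .turnEnd h ih

/-- The parameter is the position before the shift by `x s(a, b)`, so reversing the direction is a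
reflection composed with this shift. -/
theorem leafSet_flip (a b s t : ZMod (2 * n)) :
    leafSet D x b a t s = (fun p => -(p + x s(a, b))) ⁻¹' leafSet D x a b s t := by
  ext p
  simp only [leafSet, Set.mem_ofPred_eq, Set.mem_preimage]
  rw [Sym2.eq_swap (a := b), and_comm]
  simp

theorem volume_leafSet_flip (a b s t : ZMod (2 * n)) :
    volume (leafSet D x b a t s) = volume (leafSet D x a b s t) := by
  rw [leafSet_flip]
  have : (fun p => -(p + x s(a, b))) ⁻¹' leafSet D x a b s t =
      (fun p => p + x s(a, b)) ⁻¹' (Neg.neg ⁻¹' leafSet D x a b s t) := rfl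
  rw [this, measure_preimage_add_right, Measure.measure_preimage_neg]

variable [NeZero n]

theorem leaf_iff (hn : 3 ≤ n) (hD : IsHollowDissection D) {a b a' b' t : ZMod (2 * n)} {p : ℝ}
    (ha : IsNextStart D a b a') (hb : IsNextEnd D a b b') :
    Leaf D x a b p t ↔ (p < 0 ∧ Leaf D x a a' (p + x s(a, a')) t) ∨
      (0 < p ∧ Leaf D x b' b (p + x s(b', b)) t) := by
  constructor
  · intro h
    cases h with
    | last h _ => exact absurd h (ha.ne hn hD)
    | turnStart h hp h' => exact Or.inl (by rw [ha.unique h]; exact ⟨hp, h'⟩)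
    | turnEnd h hp h' => exact Or.inr (by rw [hb.unique h]; exact ⟨hp, h'⟩)
  · rintro (⟨hp, h⟩ | ⟨hp, h⟩)
    · exact .turnStart ha hp h
    · exact .turnEnd hb hp h

theorem leaf_iff_of_sbtw_start (hn : 3 ≤ n) (hD : IsHollowDissection D)
    {a b a' t : ZMod (2 * n)} {p : ℝ} (hab : IsEdge D a b) (ha : IsNextStart D a b a')
    (ht : sbtw a t a') : Leaf D x a b p t ↔ p < 0 ∧ Leaf D x a a' (p + x s(a, a')) t := by
  obtain ⟨b', hb⟩ := exists_isNextEnd hn hD hab (ha.ne hn hD)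
  rw [leaf_iff hn hD ha hb, or_iff_left]
  rintro ⟨-, h⟩
  exact not_sbtw_of_sbtw_nextStart hn hD ha hb ht (h.reach.sbtw hn)

theorem leaf_iff_of_sbtw_end (hn : 3 ≤ n) (hD : IsHollowDissection D)
    {a b b' t : ZMod (2 * n)} {p : ℝ} (hab : IsEdge D a b) (hb : IsNextEnd D a b b')
    (ht : sbtw b' t b) : Leaf D x a b p t ↔ 0 < p ∧ Leaf D x b' b (p + x s(b', b)) t := by
  obtain ⟨a', ha⟩ := exists_isNextStart hn hD hab (hb.ne hn hD hab)
  rw [leaf_iff hn hD ha hb, or_iff_right]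
  rintro ⟨-, h⟩
  exact not_sbtw_of_sbtw_nextStart hn hD ha hb (h.reach.sbtw hn) ht

theorem leaf_last_iff (hn : 3 ≤ n) (hD : IsHollowDissection D) {a t : ZMod (2 * n)} {p : ℝ}
    (ha : Odd a) : Leaf D x a (a + 2) p t ↔ t = a + 1 :=
  ⟨fun h => (reach_add_two_iff hn hD (isEdge_add_two hn ha) rfl).1 h.reach, fun h => .last rfl h⟩

/-- Leaves never cross: with the same turn both are shifted equally, and with different turns they
end in disjoint arcs, in the right order. -/
theorem Leaf.mono (hn : 3 ≤ n) (hD : IsHollowDissection D) {a b t : ZMod (2 * n)} {p : ℝ}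
    (hab : IsEdge D a b) (h : Leaf D x a b p t) : ∀ {t' : ZMod (2 * n)} {p' : ℝ},
    Leaf D x a b p' t' → p ≤ p' → ¬ sbtw a t' t := by
  induction h with
  | @last a b t p hb ht =>
    intro t' p' _ _
    subst ht
    exact not_sbtw_add_one hn _ _
  | @turnStart a b a' t p ha hp h ih =>
    intro t' p' h' hpp
    obtain ⟨b', hb⟩ := exists_isNextEnd hn hD hab (ha.ne hn hD)
    rcases (leaf_iff hn hD ha hb).1 h' with ⟨h1, h2⟩ | ⟨h1, h2⟩
    · exact ih ha.edge h2 (by linarith)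
    · have h3 := h.reach.sbtw hn
      have h4 := h2.reach.sbtw hn
      have h5 := hb.sbtw
      have h6 := not_sbtw_next hn hD ha hb
      rw [sbtw_iff_pos_lt] at h3 h5 h6 ⊢
      rw [sbtw_iff_of_lt h5.2] at h4
      omega
  | @turnEnd a b b' t p hb hp h ih =>
    intro t' p' h' hpp
    obtain ⟨a', ha⟩ := exists_isNextStart hn hD hab (hb.ne hn hD hab)
    rcases (leaf_iff hn hD ha hb).1 h' with ⟨h1, h2⟩ | ⟨h1, h2⟩
    · linarith
    · have h3 := h.reach.sbtw hn
      have h4 := h2.reach.sbtw hn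
      have h5 := hb.sbtw
      have h6 := ih hb.edge h2 (by linarith)
      rw [sbtw_iff_pos_lt] at h5 ⊢
      rw [sbtw_iff_of_lt h5.2] at h3 h4
      intro h7
      apply h6
      rw [sbtw_iff_of_lt h3.1]
      omega

theorem Leaf.unique (hn : 3 ≤ n) (hD : IsHollowDissection D) {a b t t' : ZMod (2 * n)} {p : ℝ}
    (hab : IsEdge D a b) (h : Leaf D x a b p t) (h' : Leaf D x a b p t') : t = t' := by
  have h1 := h.mono hn hD hab h' le_rfl
  have h2 := h'.mono hn hD hab h le_rfl
  have h3 := h.reach.sbtw hn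
  have h4 := h'.reach.sbtw hn
  rw [sbtw_iff_pos_lt] at *
  exact pos_injective a (by omega)

/-- Only leaves running into the centre `0` of a cell are undefined, and each cell ahead contributes
finitely many of them. -/
theorem finite_not_leaf (hn : 3 ≤ n) (hD : IsHollowDissection D) (x : Diag n → ℝ) :
    ∀ a b, IsEdge D a b → {p | ¬ ∃ t, Leaf D x a b p t}.Finite := by
  apply edge_induction hn hD (fun a b => {p | ¬ ∃ t, Leaf D x a b p t}.Finite)
  · intro a ha
    convert Set.finite_empty
    ext p
    simp [leaf_last_iff hn hD ha]
  · intro a b a' b' hab ha hb h1 h2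
    refine ((Set.finite_singleton (0 : ℝ)).union
      ((h1.preimage (add_left_injective (x s(a, a'))).injOn).union
        (h2.preimage (add_left_injective (x s(b', b))).injOn))).subset ?_
    intro p hp
    rcases lt_trichotomy p 0 with h | h | h
    · refine Or.inr (Or.inl fun ⟨t, ht⟩ => hp ⟨t, .turnStart ha h ht⟩)
    · exact Or.inl h
    · refine Or.inr (Or.inr fun ⟨t, ht⟩ => hp ⟨t, .turnEnd hb h ht⟩)

theorem measurableSet_leaf (hn : 3 ≤ n) (hD : IsHollowDissection D) (x : Diag n → ℝ)
    (t : ZMod (2 * n)) : ∀ a b, IsEdge D a b → MeasurableSet {p | Leaf D x a b p t} := by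
  apply edge_induction hn hD (fun a b => MeasurableSet {p | Leaf D x a b p t})
  · intro a ha
    simp only [leaf_last_iff hn hD ha]
    exact MeasurableSet.const _
  · intro a b a' b' hab ha hb h1 h2
    simp only [leaf_iff hn hD ha hb]
    refine MeasurableSet.union (measurableSet_Iio.inter ?_) (measurableSet_Ioi.inter ?_)
    · exact (measurable_add_const _) h1
    · exact (measurable_add_const _) h2

theorem measurableSet_leafSet (hn : 3 ≤ n) (hD : IsHollowDissection D) (x : Diag n → ℝ)
    {a b : ZMod (2 * n)} (s t : ZMod (2 * n)) (hab : IsEdge D a b) :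
    MeasurableSet (leafSet D x a b s t) := by
  refine MeasurableSet.inter ?_ ?_
  · exact (measurable_add_const _) (measurableSet_leaf hn hD x t a b hab)
  · exact measurable_neg (measurableSet_leaf hn hD x s b a hab.symm)

/-- A band of leaves crosses a cell by translation: the forward turn around `a` and the backward one
impose the same sign condition on the position. So its width is constant along the band. -/
theorem leafSet_start (hn : 3 ≤ n) (hD : IsHollowDissection D) {a b a' s t : ZMod (2 * n)}
    (hab : IsEdge D a b) (ha : IsNextStart D a b a') (ht : sbtw a t a') (hs : sbtw b s a) :
    leafSet D x a b s t = (fun p => p + x s(a, b)) ⁻¹' leafSet D x a a' s t := by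
  ext p
  simp only [leafSet, Set.mem_ofPred_eq, Set.mem_preimage]
  rw [leaf_iff_of_sbtw_start hn hD hab ha ht,
    leaf_iff_of_sbtw_end hn hD ha.edge.symm (ha.flip hab) hs, Sym2.eq_swap (a := b),
    neg_add_rev, neg_add_cancel_comm]
  constructor <;> rintro ⟨h1, h2⟩ <;> refine ⟨?_, ?_⟩ <;> first | tauto | skip
  · exact ⟨by linarith [h1.1], h2⟩
  · exact ⟨by linarith [h2.1], h1⟩

theorem leafSet_end (hn : 3 ≤ n) (hD : IsHollowDissection D) {a b b' s t : ZMod (2 * n)}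
    (hab : IsEdge D a b) (hb : IsNextEnd D a b b') (ht : sbtw b' t b) (hs : sbtw b s a) :
    leafSet D x a b s t = (fun p => p + x s(a, b)) ⁻¹' leafSet D x b' b s t := by
  ext p
  simp only [leafSet, Set.mem_ofPred_eq, Set.mem_preimage]
  rw [leaf_iff_of_sbtw_end hn hD hab hb ht,
    leaf_iff_of_sbtw_start hn hD hb.edge.symm (hb.flip hab) hs, Sym2.eq_swap (a := b),
    neg_add_rev, neg_add_cancel_comm]
  constructor <;> rintro ⟨h1, h2⟩ <;> refine ⟨?_, ?_⟩ <;> first | tauto | skip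
  · exact ⟨by linarith [h1.1], h2⟩
  · exact ⟨by linarith [h2.1], h1⟩

theorem volume_leafSet_eq (hn : 3 ≤ n) (hD : IsHollowDissection D) {a b s t : ZMod (2 * n)}
    (hab : IsEdge D a b) (h : Reach D a b t) (hs : sbtw b s a) :
    volume (leafSet D x a b s t) = volume (leafSet D x (t - 1) (t + 1) s t) := by
  induction h with
  | @last a b t hb ht => subst hb ht; rw [add_sub_cancel_right, add_assoc, one_add_one_eq_two]
  | @turnStart a b a' t ha h ih =>
    rw [leafSet_start hn hD hab ha (h.sbtw hn) hs, measure_preimage_add_right]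
    apply ih ha.edge
    have := ha.sbtw
    rw [sbtw_iff_pos a, pos_self] at *; omega
  | @turnEnd a b b' t hb h ih =>
    rw [leafSet_end hn hD hab hb (h.sbtw hn) hs, measure_preimage_add_right]
    apply ih hb.edge
    have := hb.sbtw
    rw [sbtw_iff_pos a, pos_self] at *; omega

theorem leafSet_nonempty_of (hn : 3 ≤ n) (hD : IsHollowDissection D) {a b s t : ZMod (2 * n)}
    (hab : IsEdge D a b) (h : (leafSet D x a b s t).Nonempty) : IsAccordionDiag D s(s, t) := by
  obtain ⟨p, h1, h2⟩ := h
  exact isAccordionDiag_of_reach hn hD hab h1.reach h2.reach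

/-- The leaves crossing an edge fall into the classes given by their endpoints. -/
theorem sum_volume_leafSet (hn : 3 ≤ n) (hD : IsHollowDissection D) (x : Diag n → ℝ)
    {a b : ZMod (2 * n)} (hab : IsEdge D a b) (P : Finset (ZMod (2 * n) × ZMod (2 * n)))
    (hP : ∀ s t, (s, t) ∈ P ↔ sbtw b s a ∧ sbtw a t b) {U : Set ℝ} (hU : MeasurableSet U) :
    ∑ q ∈ P, volume (leafSet D x a b q.1 q.2 ∩ U) = volume U := by
  rw [← measure_biUnion_finset]
  · apply measure_congr
    have hfin : ({p | ¬ ∃ t, Leaf D x a b (p + x s(a, b)) t} ∪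
        {p | ¬ ∃ t, Leaf D x b a (-p) t}).Finite :=
      ((finite_not_leaf hn hD x a b hab).preimage
        (add_left_injective (x s(a, b))).injOn).union
      ((finite_not_leaf hn hD x b a hab.symm).preimage neg_injective.injOn)
    have hnull : ∀ᵐ p : ℝ, p ∉ ({p | ¬ ∃ t, Leaf D x a b (p + x s(a, b)) t} ∪
        {p | ¬ ∃ t, Leaf D x b a (-p) t}) :=
      (measure_eq_zero_iff_ae_notMem).1 (hfin.measure_zero _)
    filter_upwards [hnull] with p hp
    simp only [Set.mem_union, Set.mem_ofPred_eq, not_or, not_not] at hp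
    obtain ⟨⟨t, ht⟩, ⟨s, hs⟩⟩ := hp
    apply propext
    constructor
    · intro h
      obtain ⟨q, -, hq⟩ := Set.mem_iUnion₂.1 h
      exact hq.2
    · intro h
      exact Set.mem_iUnion₂.2 ⟨(s, t), (hP s t).2 ⟨hs.reach.sbtw hn, ht.reach.sbtw hn⟩,
        ⟨ht, hs⟩, h⟩
  · intro q _ q' _ hqq
    refine Set.disjoint_left.2 ?_
    rintro p ⟨⟨h1, h2⟩, -⟩ ⟨⟨h3, h4⟩, -⟩
    exact hqq (Prod.ext (h2.unique hn hD hab.symm h4) (h1.unique hn hD hab h3))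
  · intro q _
    exact (measurableSet_leafSet hn hD x _ _ hab).inter hU

end Leaves

/-! ### The weighted lamination with given shear coordinates -/

section Weights

open MeasureTheory

variable {n : ℕ} {D : Set (Diag n)} {x : Diag n → ℝ}

theorem IsAccordionDiag.even {s t : ZMod (2 * n)} (h : IsAccordionDiag D s(s, t)) :
    Even s ∧ Even t ∧ s ≠ t := by
  obtain ⟨u, v, hu, hv, huv, h⟩ := h.1
  rcases Sym2.eq_iff.1 h with ⟨rfl, rfl⟩ | ⟨rfl, rfl⟩
  · exact ⟨hu, hv, huv⟩
  · exact ⟨hv, hu, huv.symm⟩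

open Classical in
/-- The weight of the leaves joining the endpoints of an internal accordion diagonal. -/
noncomputable def leafWeight (D : Set (Diag n)) (x : Diag n → ℝ) (δ : Diag n) : ℝ :=
  if IsAccordionDiag D δ ∧ ¬ IsBoundaryEdge δ then
    (volume (leafSet D x ((Quot.out δ).2 - 1) ((Quot.out δ).2 + 1)
      (Quot.out δ).1 (Quot.out δ).2)).toReal
  else 0

theorem leafWeight_nonneg (δ : Diag n) : 0 ≤ leafWeight D x δ := by
  unfold leafWeight; split_ifs
  · exact ENNReal.toReal_nonneg
  · exact le_rfl

theorem leafWeight_of_not {δ : Diag n} (h : ¬ (IsAccordionDiag D δ ∧ ¬ IsBoundaryEdge δ)) :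
    leafWeight D x δ = 0 := if_neg h

theorem ne_add_two_of_mem (hD : IsHollowDissection D) {a b : ZMod (2 * n)} (h : s(a, b) ∈ D) :
    b ≠ a + 2 ∧ a ≠ b + 2 := by
  constructor
  · rintro rfl
    exact hD.internal _ h ⟨a, rfl⟩
  · rintro rfl
    exact hD.internal _ h ⟨b, Sym2.eq_swap⟩

variable [NeZero n]

theorem leafWeight_eq (hn : 3 ≤ n) (hD : IsHollowDissection D) {a b s t : ZMod (2 * n)}
    (hδ : IsAccordionDiag D s(s, t)) (hδ' : ¬ IsBoundaryEdge s(s, t)) (hab : IsEdge D a b)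
    (ht : sbtw a t b) (hs : sbtw b s a) :
    leafWeight D x s(s, t) = (volume (leafSet D x a b s t)).toReal := by
  obtain ⟨es, et, hst⟩ := hδ.even
  have h1 := volume_leafSet_eq (x := x) hn hD hab (hδ.reach hn hD es et a b hab ht hs) hs
  unfold leafWeight
  rw [if_pos ⟨hδ, hδ'⟩, h1]
  have h2 : s((Quot.out s(s, t)).1, (Quot.out s(s, t)).2) = s(s, t) := Quot.out_eq _
  -- `Quot.out` may return either order of the endpoints; the reversed order is compared through the
  -- edge around `s` and a flip.
  rcases Sym2.eq_iff.1 h2 with ⟨h3, h4⟩ | ⟨h3, h4⟩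
  · rw [h3, h4]
  · rw [h3, h4]
    have e1 := isEdge_around_even (D := D) hn es
    have b1 := sbtw_around hn s
    have b2 := sbtw_around' hn et es hst.symm
    have h5 := volume_leafSet_eq (x := x) hn hD e1.symm
      (hδ.reach hn hD es et _ _ e1.symm b2 b1) b1
    rw [← h5, volume_leafSet_flip]

/-- The diagonals crossing a given edge are oriented pairs. -/
theorem sum_eq_sum_of_crosses {M : Type*} [AddCommMonoid M] [Fintype (Diag n)]
    {a b : ZMod (2 * n)} (P : Finset (ZMod (2 * n) × ZMod (2 * n)))
    (hP : ∀ s t, (s, t) ∈ P ↔ sbtw b s a ∧ sbtw a t b) (F : Diag n → M)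
    (hF : ∀ δ, ¬ Crosses s(a, b) δ → F δ = 0) :
    ∑ δ, F δ = ∑ q ∈ P, F s(q.1, q.2) := by
  classical
  have h1 : ∑ q ∈ P, F s(q.1, q.2) = ∑ δ ∈ P.image (fun q => s(q.1, q.2)), F δ := by
    rw [Finset.sum_image]
    rintro ⟨s, t⟩ h ⟨s', t'⟩ h' heq
    obtain ⟨h1, h2⟩ := (hP s t).1 h
    obtain ⟨h3, h4⟩ := (hP s' t').1 h'
    rcases Sym2.eq_iff.1 heq with ⟨h5, h6⟩ | ⟨h5, h6⟩
    · exact Prod.ext h5 h6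
    · dsimp only at h5 h6
      subst h5 h6
      rw [sbtw_iff_pos a, pos_self] at *
      omega
  rw [h1]
  symm
  apply Finset.sum_subset (Finset.subset_univ _)
  intro δ _ hδ
  apply hF
  intro hc
  apply hδ
  induction δ using Sym2.ind with
  | _ s t =>
    rcases crosses_iff.1 hc with ⟨h, h'⟩ | ⟨h, h'⟩
    · exact Finset.mem_image.2 ⟨(s, t), (hP s t).2 ⟨h', h⟩, rfl⟩
    · exact Finset.mem_image.2 ⟨(t, s), (hP t s).2 ⟨h', h⟩, Sym2.eq_swap⟩

/-- Turning around the end both ways requires `0 < p + x s(a, b)` and `0 < -p`. -/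
theorem leafSet_subset_of_turnsEnd (hn : 3 ≤ n) (hD : IsHollowDissection D)
    {a b s t : ZMod (2 * n)} (hab : IsEdge D a b) (h1 : TurnsEnd D a b t) (h2 : TurnsEnd D b a s) :
    leafSet D x a b s t ⊆ Set.Ioo (-x s(a, b)) 0 := by
  obtain ⟨b', hb, h1⟩ := h1
  obtain ⟨a', ha, h2⟩ := h2
  rintro p ⟨h3, h4⟩
  rw [leaf_iff_of_sbtw_end hn hD hab hb h1] at h3
  rw [leaf_iff_of_sbtw_end hn hD hab.symm ha h2] at h4
  constructor <;> linarith [h3.1, h4.1]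

theorem leafSet_subset_of_turnsStart (hn : 3 ≤ n) (hD : IsHollowDissection D)
    {a b s t : ZMod (2 * n)} (hab : IsEdge D a b) (h1 : TurnsStart D a b t)
    (h2 : TurnsStart D b a s) : leafSet D x a b s t ⊆ Set.Ioo 0 (-x s(a, b)) := by
  obtain ⟨b', hb, h1⟩ := h1
  obtain ⟨a', ha, h2⟩ := h2
  rintro p ⟨h3, h4⟩
  rw [leaf_iff_of_sbtw_start hn hD hab hb h1] at h3
  rw [leaf_iff_of_sbtw_start hn hD hab.symm ha h2] at h4
  constructor <;> linarith [h3.1, h4.1]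

theorem turnsEnd_of_leaf (hn : 3 ≤ n) (hD : IsHollowDissection D) {a b t : ZMod (2 * n)} {p : ℝ}
    (hab : IsEdge D a b) (hb : b ≠ a + 2) (h : Leaf D x a b p t) (hp : 0 < p) :
    TurnsEnd D a b t := by
  obtain ⟨a', ha⟩ := exists_isNextStart hn hD hab hb
  obtain ⟨b', hb⟩ := exists_isNextEnd hn hD hab hb
  rcases (leaf_iff hn hD ha hb).1 h with h | h
  · linarith [h.1]
  · exact ⟨b', hb, h.2.reach.sbtw hn⟩

theorem turnsStart_of_leaf (hn : 3 ≤ n) (hD : IsHollowDissection D) {a b t : ZMod (2 * n)} {p : ℝ}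
    (hab : IsEdge D a b) (hb : b ≠ a + 2) (h : Leaf D x a b p t) (hp : p < 0) :
    TurnsStart D a b t := by
  obtain ⟨a', ha⟩ := exists_isNextStart hn hD hab hb
  obtain ⟨b', hb⟩ := exists_isNextEnd hn hD hab hb
  rcases (leaf_iff hn hD ha hb).1 h with h | h
  · exact ⟨a', ha, h.2.reach.sbtw hn⟩
  · linarith [h.1]

theorem not_isBoundaryEdge_of_sbtw (hn : 3 ≤ n) {s t u v u' v' : ZMod (2 * n)}
    (h1 : sbtw s u t) (h2 : sbtw s v t) (huv : u ≠ v) (h1' : sbtw t u' s) (h2' : sbtw t v' s)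
    (huv' : u' ≠ v') : ¬ IsBoundaryEdge s(s, t) := by
  rintro ⟨w, hw⟩
  rcases Sym2.eq_iff.1 hw with ⟨rfl, rfl⟩ | ⟨rfl, rfl⟩
  · exact huv (by rw [eq_add_one_of_sbtw hn h1, eq_add_one_of_sbtw hn h2])
  · exact huv' (by rw [eq_add_one_of_sbtw hn h1', eq_add_one_of_sbtw hn h2'])

theorem not_isBoundaryEdge_of_turnsEnd (hn : 3 ≤ n)
    {a b s t : ZMod (2 * n)} (h1 : TurnsEnd D a b t) (h2 : TurnsEnd D b a s) :
    ¬ IsBoundaryEdge s(s, t) := by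
  obtain ⟨b', hb, h1⟩ := h1
  obtain ⟨a', ha, h2⟩ := h2
  have h5 := ha.sbtw
  have h6 := hb.sbtw
  refine not_isBoundaryEdge_of_sbtw hn (u := a) (v := b') (u' := b) (v' := a') ?_ ?_
    (sbtw_ne h6).1 ?_ ?_ (sbtw_ne h5).1
  all_goals
    rw [sbtw_iff_pos a, pos_self] at *
    omega

theorem not_isBoundaryEdge_of_turnsStart (hn : 3 ≤ n)
    {a b s t : ZMod (2 * n)} (h1 : TurnsStart D a b t) (h2 : TurnsStart D b a s) :
    ¬ IsBoundaryEdge s(s, t) := by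
  obtain ⟨a', ha, h1⟩ := h1
  obtain ⟨b', hb, h2⟩ := h2
  have h5 := ha.sbtw
  have h6 := hb.sbtw
  refine not_isBoundaryEdge_of_sbtw hn (u := a) (v := b') (u' := b) (v' := a') ?_ ?_
    (sbtw_ne h6).2.1.symm ?_ ?_ (sbtw_ne h5).2.1.symm
  all_goals
    rw [sbtw_iff_pos a, pos_self] at *
    omega

open Classical in
/-- The total weight of the `Z`s at `e` is the positive part of `x e`. -/
theorem sum_leafWeight_formsZ (hn : 3 ≤ n) (hD : IsHollowDissection D) (x : Diag n → ℝ)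
    [Fintype (Diag n)] {e : Diag n} (he : e ∈ D) :
    ∑ δ, leafWeight D x δ * (if FormsZ D e δ then 1 else 0) = max (x e) 0 := by
  classical
  induction e using Sym2.ind with
  | _ a b =>
    have hab : IsEdge D a b := Or.inl he
    obtain ⟨hb2, ha2⟩ := ne_add_two_of_mem hD he
    set P : Finset (ZMod (2 * n) × ZMod (2 * n)) :=
      Finset.univ.filter (fun q => sbtw b q.1 a ∧ sbtw a q.2 b) with hPdef
    have hP : ∀ s t, (s, t) ∈ P ↔ sbtw b s a ∧ sbtw a t b := by simp [hPdef]
    rw [sum_eq_sum_of_crosses P hP _ (fun δ h => by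
      rw [if_neg (fun h' => h h'.crosses), mul_zero])]
    have key : ∀ q ∈ P, leafWeight D x s(q.1, q.2) *
        (if FormsZ D s(a, b) s(q.1, q.2) then 1 else 0) =
        (volume (leafSet D x a b q.1 q.2 ∩ Set.Ioo (-x s(a, b)) 0)).toReal := by
      rintro ⟨s, t⟩ hq
      obtain ⟨hs, ht⟩ := (hP s t).1 hq
      rw [formsZ_iff hn hD hab ht hs]
      split_ifs with h
      · rw [mul_one, Set.inter_eq_left.2 (leafSet_subset_of_turnsEnd hn hD hab h.1 h.2)]
        by_cases hacc : IsAccordionDiag D s(s, t)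
        · exact leafWeight_eq hn hD hacc (not_isBoundaryEdge_of_turnsEnd hn h.1 h.2) hab ht hs
        · rw [leafWeight_of_not (fun h => hacc h.1)]
          have : leafSet D x a b s t = ∅ := by
            rw [← Set.not_nonempty_iff_eq_empty]
            exact fun h => hacc (leafSet_nonempty_of hn hD hab h)
          rw [this]; simp
      · have : leafSet D x a b s t ∩ Set.Ioo (-x s(a, b)) 0 = ∅ := by
          rw [← Set.not_nonempty_iff_eq_empty]
          rintro ⟨p, ⟨h1, h2⟩, h3, h4⟩
          exact h ⟨turnsEnd_of_leaf hn hD hab hb2 h1 (by linarith),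
            turnsEnd_of_leaf hn hD hab.symm ha2 h2 (by linarith)⟩
        rw [this]; simp
    -- Conversely every leaf positioned in this interval forms a `Z`, so the classes fill it up to a
    -- null set.
    rw [Finset.sum_congr rfl key, ← ENNReal.toReal_sum,
      sum_volume_leafSet hn hD x hab P hP measurableSet_Ioo, Real.volume_Ioo]
    · simp [ENNReal.toReal_ofReal']
    · intro q _
      refine ne_top_of_le_ne_top ?_ (measure_mono Set.inter_subset_right)
      rw [Real.volume_Ioo]
      exact ENNReal.ofReal_ne_top

open Classical in
/-- The total weight of the `S`s at `e` is the negative part of `x e`. -/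
theorem sum_leafWeight_formsS (hn : 3 ≤ n) (hD : IsHollowDissection D) (x : Diag n → ℝ)
    [Fintype (Diag n)] {e : Diag n} (he : e ∈ D) :
    ∑ δ, leafWeight D x δ * (if FormsS D e δ then 1 else 0) = max (-x e) 0 := by
  classical
  induction e using Sym2.ind with
  | _ a b =>
    have hab : IsEdge D a b := Or.inl he
    obtain ⟨hb2, ha2⟩ := ne_add_two_of_mem hD he
    set P : Finset (ZMod (2 * n) × ZMod (2 * n)) :=
      Finset.univ.filter (fun q => sbtw b q.1 a ∧ sbtw a q.2 b) with hPdef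
    have hP : ∀ s t, (s, t) ∈ P ↔ sbtw b s a ∧ sbtw a t b := by simp [hPdef]
    rw [sum_eq_sum_of_crosses P hP _ (fun δ h => by
      rw [if_neg (fun h' => h h'.crosses), mul_zero])]
    have key : ∀ q ∈ P, leafWeight D x s(q.1, q.2) *
        (if FormsS D s(a, b) s(q.1, q.2) then 1 else 0) =
        (volume (leafSet D x a b q.1 q.2 ∩ Set.Ioo 0 (-x s(a, b)))).toReal := by
      rintro ⟨s, t⟩ hq
      obtain ⟨hs, ht⟩ := (hP s t).1 hq
      rw [formsS_iff hn hD hab ht hs]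
      split_ifs with h
      · rw [mul_one, Set.inter_eq_left.2 (leafSet_subset_of_turnsStart hn hD hab h.1 h.2)]
        by_cases hacc : IsAccordionDiag D s(s, t)
        · exact leafWeight_eq hn hD hacc (not_isBoundaryEdge_of_turnsStart hn h.1 h.2) hab ht hs
        · rw [leafWeight_of_not (fun h => hacc h.1)]
          have : leafSet D x a b s t = ∅ := by
            rw [← Set.not_nonempty_iff_eq_empty]
            exact fun h => hacc (leafSet_nonempty_of hn hD hab h)
          rw [this]; simp
      · have : leafSet D x a b s t ∩ Set.Ioo 0 (-x s(a, b)) = ∅ := by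
          rw [← Set.not_nonempty_iff_eq_empty]
          rintro ⟨p, ⟨h1, h2⟩, h3, h4⟩
          exact h ⟨turnsStart_of_leaf hn hD hab hb2 h1 (by linarith),
            turnsStart_of_leaf hn hD hab.symm ha2 h2 (by linarith)⟩
        rw [this]; simp
    rw [Finset.sum_congr rfl key, ← ENNReal.toReal_sum,
      sum_volume_leafSet hn hD x hab P hP measurableSet_Ioo, Real.volume_Ioo]
    · simp [ENNReal.toReal_ofReal']
    · intro q _
      refine ne_top_of_le_ne_top ?_ (measure_mono Set.inter_subset_right)
      rw [Real.volume_Ioo]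
      exact ENNReal.ofReal_ne_top

theorem not_formsZ_and_formsS (hn : 3 ≤ n) (hD : IsHollowDissection D) {e δ : Diag n} :
    ¬ (FormsZ D e δ ∧ FormsS D e δ) := by
  rintro ⟨h1, h2⟩
  have hc := h1.crosses
  have he : e ∈ withBoundary D := by
    obtain ⟨_, _, _, _, _, _, _, h, _⟩ := h1
    exact h.1.1
  induction e using Sym2.ind with
  | _ a b =>
    induction δ using Sym2.ind with
    | _ s t =>
      have key : ∀ s t : ZMod (2 * n), sbtw a t b → sbtw b s a → FormsZ D s(a, b) s(s, t) →
          FormsS D s(a, b) s(s, t) → False := by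
        intro s t ht hs h1 h2
        rw [formsZ_iff hn hD he ht hs] at h1
        rw [formsS_iff hn hD he ht hs] at h2
        exact not_turnsStart_and_turnsEnd hn hD ⟨h2.1, h1.1⟩
      rcases crosses_iff.1 hc with ⟨h, h'⟩ | ⟨h, h'⟩
      · exact key s t h h' h1 h2
      · rw [Sym2.eq_swap (a := s)] at h1 h2
        exact key t s h h' h1 h2

theorem slalomSign_eq (hn : 3 ≤ n) (hD : IsHollowDissection D) (e δ : Diag n)
    [Decidable (FormsZ D e δ)] [Decidable (FormsS D e δ)] : slalomSign D e δ =
    (if FormsZ D e δ then 1 else 0) - (if FormsS D e δ then 1 else 0) := by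
  have := not_formsZ_and_formsS hn hD (e := e) (δ := δ)
  unfold slalomSign
  split_ifs <;> simp_all

/-- Every vector is the combination of the g-vectors given by its lamination. -/
theorem sum_leafWeight_mul_slalomSign (hn : 3 ≤ n) (hD : IsHollowDissection D) (x : Diag n → ℝ)
    [Fintype (Diag n)] {e : Diag n} (he : e ∈ D) :
    ∑ δ, leafWeight D x δ * slalomSign D e δ = x e := by
  classical
  simp only [slalomSign_eq hn hD, mul_sub, Finset.sum_sub_distrib]
  rw [sum_leafWeight_formsZ hn hD x he, sum_leafWeight_formsS hn hD x he]
  rcases le_total 0 (x e) with h | h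
  · rw [max_eq_left h, max_eq_right (by linarith)]; ring
  · rw [max_eq_right h, max_eq_left (by linarith)]; ring

/-- Crossing accordion diagonals cross a common edge. -/
theorem exists_common_edge (hn : 3 ≤ n) (hD : IsHollowDissection D) {s t s' t' : ZMod (2 * n)}
    (h : IsAccordionDiag D s(s, t)) (es' : Even s') (et' : Even t') (h1 : sbtw s t' t)
    (h2 : sbtw t s' s) :
    ∃ a b, IsEdge D a b ∧ sbtw a t b ∧ sbtw b s a ∧
      ((sbtw a t' b ∧ sbtw b s' a) ∨ (sbtw a s' b ∧ sbtw b t' a)) := by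
  obtain ⟨es, et, hst⟩ := h.even
  by_contra hcon
  have hfirst : s(s - 1, s + 1) ∈ cut D s(s, t) :=
    mem_cut.2 ⟨isEdge_around_even hn es, Or.inr ⟨sbtw_around hn s, sbtw_around' hn et es hst.symm⟩⟩
  have hlast : s(t - 1, t + 1) ∈ cut D s(s, t) :=
    mem_cut.2 ⟨isEdge_around_even hn et, Or.inl ⟨sbtw_around hn t, sbtw_around' hn es et hst⟩⟩
  have g1 := h1
  have g2 := h2
  rw [sbtw_iff_pos_lt] at g1
  rw [sbtw_iff_lt_pos (a := s)] at g2
  -- If no edge of the cut crosses `s't'`, each has both `t'` and `s'` on the side of `t`, or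
  -- neither. Changing one endpoint cannot switch type, yet the edges around `s` and around `t` have
  -- different types.
  have key : ∀ f, Relation.ReflTransGen (fun x y => y ∈ cut D s(s, t) ∧ ∃ v, v ∈ x ∧ v ∈ y)
      s(s - 1, s + 1) f → ∃ u v, f = s(u, v) ∧ 0 < pos s u ∧ pos s u < pos s t' ∧
        pos s s' < pos s v := by
    intro f hf
    induction hf with
    | refl =>
      refine ⟨s + 1, s - 1, Sym2.eq_swap, ?_⟩
      have b1 := not_sbtw_add_one hn s t'
      have b2 := not_sbtw_add_one hn (s - 1) s'
      rw [sub_add_cancel] at b2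
      have c1 := (pos_injective s).ne (ne_of_odd_of_even (es.add_odd odd_one) et')
      have c2 := (pos_injective s).ne (ne_of_odd_of_even (es.sub_odd odd_one) es')
      have c3 := pos_add_one hn s
      have c4 := (pos_injective s).ne (ne_of_odd_of_even (es.sub_odd odd_one) es)
      rw [sbtw_iff_pos_lt] at b1
      rw [sbtw_iff_lt_pos (a := s)] at b2
      rw [pos_self] at c4
      omega
    | @tail e f _ hef ih =>
      obtain ⟨u, v, rfl, hu0, hu, hv⟩ := ih
      obtain ⟨hf, w, hw1, hw2⟩ := hef
      have : ∃ x y, f = s(x, y) ∧ IsEdge D x y ∧ sbtw x t y ∧ sbtw y s x := by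
        induction f using Sym2.ind with
        | _ x y =>
          rcases mem_cut.1 hf with ⟨h1, h2 | h2⟩
          · exact ⟨x, y, rfl, h1, h2⟩
          · exact ⟨y, x, Sym2.eq_swap, h1.symm, h2.2, h2.1⟩
      obtain ⟨x, y, rfl, hxy, hx, hy⟩ := this
      refine ⟨x, y, rfl, ?_⟩
      have hc : ¬ _ := fun h => hcon ⟨x, y, hxy, hx, hy, h⟩
      have ho := hxy.odd hD
      have c1 := (pos_injective s).ne (ne_of_odd_of_even ho.1 et')
      have c2 := (pos_injective s).ne (ne_of_odd_of_even ho.2.1 es')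
      have hy0 : pos s x < pos s y := by
        rw [sbtw_iff_pos s] at hx hy; rw [pos_self] at hy; omega
      rw [sbtw_iff_of_lt hy0] at hx
      rw [sbtw_iff_of_lt hy0, sbtw_iff_of_lt hy0, sbtw_iff_pos s, sbtw_iff_pos s (x := y)] at hc
      rw [sbtw_iff_pos s, pos_self] at hy
      have hw : u = x ∨ v = y ∨ u = y ∨ v = x := by
        rw [Sym2.mem_iff] at hw1 hw2
        rcases hw1 with h1 | h1 <;> rcases hw2 with h2 | h2
        · exact Or.inl (h1.symm.trans h2)
        · exact Or.inr (Or.inr (Or.inl (h1.symm.trans h2)))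
        · exact Or.inr (Or.inr (Or.inr (h1.symm.trans h2)))
        · exact Or.inr (Or.inl (h1.symm.trans h2))
      rcases hw with rfl | rfl | rfl | rfl <;> omega
  obtain ⟨u, v, huv, hu0, hu, hv⟩ := key _ (h.2 _ hfirst _ hlast)
  have n1 := not_sbtw_add_one hn (t - 1) t'
  have n3 := sbtw_around hn t
  have n4 := sbtw_around' hn es et hst
  rw [sub_add_cancel] at n1
  rw [sbtw_iff_pos s] at n1 n3 n4
  rw [pos_self] at n4
  rcases Sym2.eq_iff.1 huv with ⟨rfl, rfl⟩ | ⟨rfl, rfl⟩ <;> omega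

/-- The diagonals of positive weight are pairwise non-crossing. -/
theorem not_crosses_of_leafWeight_pos (hn : 3 ≤ n) (hD : IsHollowDissection D) {γ δ : Diag n}
    (hγ : 0 < leafWeight D x γ) (hδ : 0 < leafWeight D x δ) : ¬ Crosses γ δ := by
  rintro ⟨s, t, t', s', rfl, rfl, h1, h2⟩
  have hA : ∀ {δ}, 0 < leafWeight D x δ → IsAccordionDiag D δ ∧ ¬ IsBoundaryEdge δ := by
    intro δ h
    by_contra h'
    rw [leafWeight_of_not h'] at h
    exact lt_irrefl _ h
  obtain ⟨A1, B1⟩ := hA hγ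
  obtain ⟨A2, B2⟩ := hA hδ
  rw [Sym2.eq_swap (a := t')] at hδ A2 B2
  obtain ⟨es', et', -⟩ := A2.even
  have hne : ∀ {S : Set ℝ}, 0 < (volume S).toReal → S.Nonempty := by
    intro S h
    by_contra h'
    rw [Set.not_nonempty_iff_eq_empty.1 h'] at h
    simp at h
  have key : ∀ {a b s t s' t'}, IsEdge D a b → (leafSet D x a b s t).Nonempty →
      (leafSet D x a b s' t').Nonempty →
      ¬ (sbtw s t' t ∧ sbtw t s' s) ∧ ¬ (sbtw s s' t ∧ sbtw t t' s) := by
    rintro a b s t s' t' hab ⟨p, k1, k2⟩ ⟨p', k3, k4⟩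
    have h3 := k1.reach.sbtw hn
    have h4 := k2.reach.sbtw hn
    have h5 := k3.reach.sbtw hn
    have h6 := k4.reach.sbtw hn
    rw [sbtw_iff_pos_lt] at h3 h5
    rw [sbtw_iff_lt_pos (a := a)] at h4 h6
    simp only [sbtw_iff_pos a]
    -- Positions change sign when read backwards, so the order at the `t` ends and the order at the
    -- `s` ends are both determined by `p` and `p'`, and they rule out a crossing.
    rcases le_total p p' with hp | hp
    · have m1 := k1.mono hn hD hab k3 (by linarith)
      have m2 := k4.mono hn hD hab.symm k2 (by linarith)
      rw [sbtw_iff_pos_lt] at m1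
      rw [sbtw_iff_pos a] at m2
      omega
    · have m1 := k3.mono hn hD hab k1 (by linarith)
      have m2 := k2.mono hn hD hab.symm k4 (by linarith)
      rw [sbtw_iff_pos_lt] at m1
      rw [sbtw_iff_pos a] at m2
      omega
  obtain ⟨a, b, hab, h3, h4, ⟨h5, h6⟩ | ⟨h5, h6⟩⟩ := exists_common_edge hn hD A1 es' et' h1 h2
  · rw [leafWeight_eq hn hD A1 B1 hab h3 h4] at hγ
    rw [leafWeight_eq hn hD A2 B2 hab h5 h6] at hδ
    exact (key hab (hne hγ) (hne hδ)).1 ⟨h1, h2⟩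
  · rw [leafWeight_eq hn hD A1 B1 hab h3 h4] at hγ
    rw [Sym2.eq_swap (a := s')] at hδ A2 B2
    rw [leafWeight_eq hn hD A2 B2 hab h5 h6] at hδ
    exact (key hab (hne hγ) (hne hδ)).2 ⟨h1, h2⟩

/-- A path already turning around `a` makes a `Z` the first time it turns around an end; if it never
does, it circles `a` up to the boundary edge from `a` to `a + 2`. -/
theorem Reach.exists_formsZ (hn : 3 ≤ n) (hD : IsHollowDissection D) {a b s t : ZMod (2 * n)}
    (hab : IsEdge D a b) (h : Reach D a b t) (hs : SBtw.sbtw b s a) (hs' : TurnsEnd D b a s) :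
    (∃ e ∈ D, FormsZ D e s(s, t)) ∨ t = a + 1 := by
  induction h with
  | last hb ht => exact Or.inr ht
  | @turnStart a b a' t ha h ih =>
    refine ih ha.edge ?_ ⟨b, ha.flip hab, hs⟩
    have := ha.sbtw
    rw [sbtw_iff_pos a, pos_self] at *; omega
  | @turnEnd a b b' t hb h ih =>
    obtain ⟨a', ha, hsa⟩ := hs'
    exact Or.inl ⟨s(a, b), mem_of_isEdge hab (hb.ne hn hD hab) (ha.ne hn hD hab.symm),
      (formsZ_iff hn hD hab (hb.sbtw_trans (h.sbtw hn)) hs).2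
        ⟨⟨b', hb, h.sbtw hn⟩, ⟨a', ha, hsa⟩⟩⟩

theorem Reach.exists_formsS (hn : 3 ≤ n) (hD : IsHollowDissection D) {a b s t : ZMod (2 * n)}
    (hab : IsEdge D a b) (h : Reach D a b t) (hs : SBtw.sbtw b s a) (hs' : TurnsStart D b a s) :
    (∃ e ∈ D, FormsS D e s(s, t)) ∨ t + 1 = b := by
  induction h with
  | last hb ht => exact Or.inr (by rw [hb, ht]; ring)
  | @turnEnd a b b' t hb h ih =>
    refine ih hb.edge ?_ ⟨a, hb.flip hab, hs⟩
    have := hb.sbtw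
    rw [sbtw_iff_pos a, pos_self] at *; omega
  | @turnStart a b a' t ha h ih =>
    obtain ⟨b', hb, hsb⟩ := hs'
    exact Or.inl ⟨s(a, b), mem_of_isEdge hab (ha.ne hn hD) (hb.ne hn hD),
      (formsS_iff hn hD hab (ha.sbtw_trans (h.sbtw hn)) hs).2
        ⟨⟨a', ha, h.sbtw hn⟩, ⟨b', hb, hsb⟩⟩⟩

/-- An internal accordion diagonal has a nonzero sign somewhere. -/
theorem IsAccordionDiag.exists_sign (hn : 3 ≤ n) (hD : IsHollowDissection D) {δ : Diag n}
    (h : IsAccordionDiag D δ) (h' : ¬ IsBoundaryEdge δ) :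
    ∃ e ∈ D, FormsZ D e δ ∨ FormsS D e δ := by
  induction δ using Sym2.ind with
  | _ s t =>
    obtain ⟨es, et, hst⟩ := h.even
    have b1 := sbtw_around hn s
    have b2 := sbtw_around' hn et es hst.symm
    have hab := (isEdge_around_even (D := D) hn es).symm
    have hr := h.reach hn hD es et _ _ hab b2 b1
    have t1 : t ≠ s + 1 + 1 := by
      rintro rfl
      exact h' ⟨s, by rw [add_assoc, one_add_one_eq_two]⟩
    have t2 : t + 1 ≠ s - 1 := by
      intro ht
      refine h' ⟨t, ?_⟩
      rw [show s = t + 2 by linear_combination -ht]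
      exact Sym2.eq_swap
    cases hr with
    | last hb ht => exact absurd ht t1
    | @turnStart _ _ a' _ ha hr =>
      have hs : sbtw a' s (s + 1) := by
        have := ha.sbtw
        rw [sbtw_iff_pos s, pos_self] at *; omega
      rcases hr.exists_formsZ hn hD ha.edge hs ⟨_, ha.flip hab, b1⟩ with ⟨e, he, hz⟩ | ht
      · exact ⟨e, he, Or.inl hz⟩
      · exact absurd ht t1
    | @turnEnd _ _ b' _ hb hr =>
      have hs : sbtw (s - 1) s b' := by
        have := hb.sbtw
        rw [sbtw_iff_pos s, pos_self] at *; omega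
      rcases hr.exists_formsS hn hD hb.edge hs ⟨_, hb.flip hab, b1⟩ with ⟨e, he, hz⟩ | ht
      · exact ⟨e, he, Or.inr hz⟩
      · exact absurd ht t2

end Weights

/-! ### Recovering a weighted lamination from its shear coordinates -/

section Uniqueness

open MeasureTheory

variable {n : ℕ} {D E : Set (Diag n)} {x w : Diag n → ℝ}

/-- The diagonal `q` crosses `ab` and turns around `b` afterwards. -/
def PassesEnd (D : Set (Diag n)) (a b : ZMod (2 * n)) (q : ZMod (2 * n) × ZMod (2 * n)) : Prop :=
  sbtw b q.1 a ∧ TurnsEnd D a b q.2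

/-- The diagonal `q` lies weakly between the diagonal `st` and the vertex `b`. -/
def Beyond (s t b : ZMod (2 * n)) (q : ZMod (2 * n) × ZMod (2 * n)) : Prop :=
  (q.2 = t ∨ sbtw t q.2 b) ∧ (q.1 = s ∨ sbtw b q.1 s)

open Classical in
/-- The position at which the strip of the diagonal `st` in the weighted lamination `w` starts after
crossing the edge `ab`. -/
noncomputable def stripPos [NeZero n] (D : Set (Diag n)) (w : Diag n → ℝ)
    (s t a b : ZMod (2 * n)) : ℝ :=
  -- The strips over `ab` are stacked from `a` to `b`, with `0` separating those turning around `a`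
  -- from those turning around `b`. The top of the stack is the total weight turning around `b`;
  -- removing `st` and everything beyond it gives the lower end of its strip.
  ∑ q : ZMod (2 * n) × ZMod (2 * n), w s(q.1, q.2) *
    ((if PassesEnd D a b q then 1 else 0) - (if Beyond s t b q then 1 else 0))

theorem not_crosses_pair {s t s' t' : ZMod (2 * n)} (h : ¬ Crosses s(s, t) s(s', t')) :
    ¬ (sbtw s t' t ∧ sbtw t s' s) ∧ ¬ (sbtw s s' t ∧ sbtw t t' s) := by
  rw [crosses_iff] at h
  exact ⟨fun h' => h (Or.inl h'), fun h' => h (Or.inr h')⟩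

variable [NeZero n]

-- For an accordion diagonal crossing `ab`, the sign is the number of its two turns made around
-- ends, minus one. This form can be compared with `stripPos` one diagonal at a time.
open Classical in
theorem shear_eq (hn : 3 ≤ n) (hD : IsHollowDissection D) (hE : IsAccordionDissection D E)
    (hw : ∀ δ, δ ∉ E → w δ = 0) [Fintype (Diag n)] {a b : ZMod (2 * n)} (he : s(a, b) ∈ D) :
    ∑ δ, w δ * slalomSign D s(a, b) δ =
      ∑ q : ZMod (2 * n) × ZMod (2 * n), w s(q.1, q.2) *
        (if sbtw b q.1 a ∧ sbtw a q.2 b then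
          (if TurnsEnd D a b q.2 then 1 else 0) + (if TurnsEnd D b a q.1 then 1 else 0) - 1
        else 0) := by
  have hab : IsEdge D a b := Or.inl he
  obtain ⟨hb2, ha2⟩ := ne_add_two_of_mem hD he
  rw [sum_eq_sum_of_crosses (Finset.univ.filter (fun q => sbtw b q.1 a ∧ sbtw a q.2 b))
    (a := a) (b := b) (by simp) _ (fun δ h => by
      rw [slalomSign_eq hn hD, if_neg (fun h' => h h'.crosses), if_neg (fun h' => h h'.crosses)]
      simp), Finset.sum_filter]
  refine Finset.sum_congr rfl ?_
  rintro ⟨s, t⟩ -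
  dsimp only
  by_cases h : sbtw b s a ∧ sbtw a t b
  · rw [if_pos h, if_pos h]
    by_cases hmem : s(s, t) ∈ E
    · have hacc := hE.accordion _ hmem
      obtain ⟨es, et, -⟩ := hacc.even
      have r1 := (hacc.reach hn hD es et a b hab h.2 h.1).turns hn hb2
      rw [Sym2.eq_swap] at hacc
      have r2 := (hacc.reach hn hD et es b a hab.symm h.1 h.2).turns hn ha2
      have n1 := not_turnsStart_and_turnsEnd hn hD (a := a) (b := b) (t := t)
      have n2 := not_turnsStart_and_turnsEnd hn hD (a := b) (b := a) (t := s)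
      rw [slalomSign_eq hn hD, formsZ_iff hn hD hab h.2 h.1, formsS_iff hn hD hab h.2 h.1]
      congr 1
      by_cases c1 : TurnsEnd D a b t <;> by_cases c2 : TurnsEnd D b a s
      · have : ¬ TurnsStart D a b t := fun h => n1 ⟨h, c1⟩
        simp [c1, c2, this]
      · have : ¬ TurnsStart D a b t := fun h => n1 ⟨h, c1⟩
        simp [c1, c2, this]
      · have : ¬ TurnsStart D b a s := fun h => n2 ⟨h, c2⟩
        simp [c1, c2, this]
      · simp [c1, c2, r1.resolve_right c1, r2.resolve_right c2]
    · rw [hw _ hmem]; simp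
  · rw [if_neg h, if_neg h, mul_zero]

theorem indicator_start {U U' V V' B B' C G G' P P' : Prop} [Decidable P] [Decidable G]
    [Decidable (U' ∧ V')] [Decidable B'] [Decidable C] [Decidable P'] [Decidable G']
    (hP : P ↔ U ∧ B) (hP' : P' ↔ U' ∧ B') (hC : C ↔ U)
    (h1 : U → U') (h2 : V' → V) (h3 : B' → V')
    (h4 : B → V) (h5 : U → V → V' ∨ B) (h6 : V' → ¬ B) (h7 : G → U ∧ V) (h8 : G' → U' ∧ V')
    (h9 : (U ∧ V ∧ ¬ G) ↔ (U' ∧ V' ∧ ¬ G')) :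
    ((if P then (1 : ℝ) else 0) - (if G then 1 else 0)) +
      (if U' ∧ V' then (if B' then 1 else 0) + (if C then 1 else 0) - 1 else 0) =
      (if P' then 1 else 0) - (if G' then 1 else 0) := by
  by_cases hU : U
  · by_cases hV' : V'
    · grind
    · grind
  · grind

theorem indicator_end {U U' V' B' C G P P' : Prop} [Decidable P] [Decidable G]
    [Decidable (U' ∧ V')] [Decidable B'] [Decidable C] [Decidable P']
    (hP : P ↔ U ∧ V') (hP' : P' ↔ U' ∧ B')
    (h1 : U → U') (h2 : B' → V') (h3 : U' → V' → (C ↔ ¬ U)) :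
    ((if P then (1 : ℝ) else 0) - (if G then 1 else 0)) +
      (if U' ∧ V' then (if B' then 1 else 0) + (if C then 1 else 0) - 1 else 0) =
      (if P' then 1 else 0) - (if G then 1 else 0) := by
  by_cases hU : U
  · grind
  · grind

theorem indicator_sub_nonneg {P G : Prop} [Decidable P] [Decidable G] (h : G → P) :
    (0 : ℝ) ≤ (if P then 1 else 0) - (if G then 1 else 0) := by
  grind

theorem indicator_sub_add_nonpos {P G Q : Prop} [Decidable P] [Decidable G] [Decidable Q]
    (h : P → G) (h' : Q → G) (h'' : P → ¬ Q) :
    (if P then (1 : ℝ) else 0) - (if G then 1 else 0) + (if Q then 1 else 0) ≤ 0 := by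
  grind

-- Strips translate across a cell exactly as leaves do. Since `st` turns around `a`, the diagonals
-- of `E` on its `a` side crossing `ab` are the same as those crossing `aa'`; this is where
-- non-crossing enters.
open Classical in
theorem stripPos_start (hn : 3 ≤ n) (hD : IsHollowDissection D) (hE : IsAccordionDissection D E)
    (hw : ∀ δ, δ ∉ E → w δ = 0) [Fintype (Diag n)]
    (hx : ∀ e ∈ D, ∑ δ, w δ * slalomSign D e δ = x e) {s t a b a' : ZMod (2 * n)}
    (hst : s(s, t) ∈ E) (hab : IsEdge D a b) (ha : IsNextStart D a b a') (he : s(a, a') ∈ D)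
    (ht : sbtw a t a') (hs : sbtw b s a) :
    stripPos D w s t a b + x s(a, a') = stripPos D w s t a a' := by
  rw [← hx _ he, shear_eq hn hD hE hw he]
  unfold stripPos
  rw [← Finset.sum_add_distrib]
  refine Finset.sum_congr rfl ?_
  rintro ⟨s', t'⟩ -
  rw [← mul_add]
  by_cases hmem : s(s', t') ∈ E
  swap
  · rw [hw _ hmem]; simp
  congr 1
  dsimp only
  have hacc := hE.accordion _ hmem
  obtain ⟨es, et, -⟩ := hacc.even
  have hnc := not_crosses_pair (hE.noncrossing _ hst _ hmem)
  obtain ⟨b', hb⟩ := exists_isNextEnd hn hD hab (ha.ne hn hD)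
  have haa := ha.sbtw
  have hbb := hb.sbtw
  have k1 : TurnsEnd D a' a s' ↔ sbtw b s' a :=
    ⟨fun ⟨c, hc, h⟩ => hc.unique (ha.flip hab) ▸ h, fun h => ⟨b, ha.flip hab, h⟩⟩
  have k2 : TurnsEnd D a a' t' → sbtw a t' a' := TurnsEnd.sbtw
  have k3 : TurnsEnd D a b t' → sbtw a t' b := TurnsEnd.sbtw
  have k4 : sbtw b s' a → sbtw a t' b → (sbtw a t' a' ∨ TurnsEnd D a b t') := by
    intro h1 h2
    refine ((hacc.reach hn hD es et a b hab h2 h1).turns hn (ha.ne hn hD)).imp_left ?_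
    rintro ⟨c, hc, h⟩
    exact hc.unique ha ▸ h
  have k5 : sbtw a t' a' → ¬ TurnsEnd D a b t' :=
    fun h1 h2 => not_turnsStart_and_turnsEnd hn hD ⟨⟨a', ha, h1⟩, h2⟩
  have g1 : sbtw b s' a → sbtw a' s' a := by
    simp only [sbtw_iff_pos a, pos_self] at *
    omega
  have g2 : sbtw a t' a' → sbtw a t' b := ha.sbtw_trans
  rw [sbtw_iff_pos_lt] at haa ht
  rw [sbtw_iff_lt_pos (a := a)] at hs
  have q1 : sbtw b s' a ↔ pos a b < pos a s' := by rw [sbtw_iff_lt_pos (a := a)]; omega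
  have q2 : sbtw a' s' a ↔ pos a a' < pos a s' := by rw [sbtw_iff_lt_pos (a := a)]; omega
  have q3 : sbtw a t' b ↔ 0 < pos a t' ∧ pos a t' < pos a b := sbtw_iff_pos_lt
  have q4 : sbtw a t' a' ↔ 0 < pos a t' ∧ pos a t' < pos a a' := sbtw_iff_pos_lt
  have q5 : sbtw t t' b ↔ pos a t < pos a t' ∧ pos a t' < pos a b := sbtw_iff_of_lt (by omega)
  have q6 : sbtw t t' a' ↔ pos a t < pos a t' ∧ pos a t' < pos a a' := sbtw_iff_of_lt (by omega)
  have q7 : sbtw b s' s ↔ pos a b < pos a s' ∧ pos a s' < pos a s := sbtw_iff_of_lt (by omega)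
  have q8 : sbtw a' s' s ↔ pos a a' < pos a s' ∧ pos a s' < pos a s := sbtw_iff_of_lt (by omega)
  have q9 : t' = t ↔ pos a t' = pos a t := (pos_injective a).eq_iff.symm
  have q10 : s' = s ↔ pos a s' = pos a s := (pos_injective a).eq_iff.symm
  have g3 : ((t' = t ∨ sbtw t t' b) ∧ (s' = s ∨ sbtw b s' s)) → sbtw b s' a ∧ sbtw a t' b := by
    rw [q1, q3, q5, q7, q9, q10]; omega
  have g4 : ((t' = t ∨ sbtw t t' a') ∧ (s' = s ∨ sbtw a' s' s)) → sbtw a' s' a ∧ sbtw a t' a' := by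
    rw [q2, q4, q6, q8, q9, q10]; omega
  have g5 : (sbtw b s' a ∧ sbtw a t' b ∧ ¬ ((t' = t ∨ sbtw t t' b) ∧ (s' = s ∨ sbtw b s' s))) ↔
    (sbtw a' s' a ∧ sbtw a t' a' ∧ ¬ ((t' = t ∨ sbtw t t' a') ∧ (s' = s ∨ sbtw a' s' s))) := by
    have n1 := hnc.1
    rw [sbtw_iff_of_lt (o := a) (x := t) (by omega), sbtw_iff_pos a] at n1
    have n2 := hnc.2
    rw [sbtw_iff_of_lt (o := a) (x := t) (by omega), sbtw_iff_pos a] at n2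
    rw [q1, q2, q3, q4, q5, q6, q7, q8, q9, q10]
    omega
  exact indicator_start Iff.rfl Iff.rfl k1 g1 g2 k2 k3 k4 k5 g3 g4 g5

open Classical in
theorem stripPos_end (hn : 3 ≤ n) (hD : IsHollowDissection D) (hE : IsAccordionDissection D E)
    (hw : ∀ δ, δ ∉ E → w δ = 0) [Fintype (Diag n)]
    (hx : ∀ e ∈ D, ∑ δ, w δ * slalomSign D e δ = x e) {s t a b b' : ZMod (2 * n)}
    (hab : IsEdge D a b) (hb : IsNextEnd D a b b') (he : s(b', b) ∈ D) :
    stripPos D w s t a b + x s(b', b) = stripPos D w s t b' b := by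
  rw [← hx _ he, shear_eq hn hD hE hw he]
  unfold stripPos
  rw [← Finset.sum_add_distrib]
  refine Finset.sum_congr rfl ?_
  rintro ⟨s', t'⟩ -
  rw [← mul_add]
  by_cases hmem : s(s', t') ∈ E
  swap
  · rw [hw _ hmem]; simp
  congr 1
  dsimp only
  have hacc := hE.accordion _ hmem
  obtain ⟨es, et, -⟩ := hacc.even
  have hbb := hb.sbtw
  have k1 : TurnsEnd D a b t' ↔ sbtw b' t' b :=
    ⟨fun ⟨c, hc, h⟩ => hc.unique hb ▸ h, fun h => ⟨b', hb, h⟩⟩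
  have g1 : sbtw b s' a → sbtw b s' b' := by
    simp only [sbtw_iff_pos a, pos_self] at *
    omega
  -- Read backwards from `b'b`, a diagonal either turns around `b` and leaves through `ab`, or turns
  -- around `b'`.
  have k3 : sbtw b s' b' → sbtw b' t' b → (TurnsEnd D b b' s' ↔ ¬ sbtw b s' a) := by
    intro h1 h2
    rw [Sym2.eq_swap] at hacc
    have hr := (hacc.reach hn hD et es b b' hb.edge.symm h1 h2).turns hn
      (ne_add_two_of_mem hD he).2
    have hT : TurnsStart D b b' s' ↔ sbtw b s' a :=
      ⟨fun ⟨c, hc, h⟩ => hc.unique (hb.flip hab) ▸ h, fun h => ⟨a, hb.flip hab, h⟩⟩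
    rw [hT] at hr
    refine ⟨fun h h' => not_turnsStart_and_turnsEnd hn hD ⟨hT.2 h', h⟩, hr.resolve_left⟩
  have k2 : TurnsEnd D b' b t' → sbtw b' t' b := TurnsEnd.sbtw
  exact indicator_end (and_congr_right fun _ => k1) Iff.rfl g1 k2 k3

/-- At each turn of `st` its whole strip lies on the side of `0` that makes leaves turn the same
way, and strip and leaf then receive the same shift. -/
theorem leaf_of_mem_strip (hn : 3 ≤ n) (hD : IsHollowDissection D)
    (hE : IsAccordionDissection D E) (hw0 : ∀ δ, 0 ≤ w δ)
    (hw : ∀ δ, δ ∉ E → w δ = 0) [Fintype (Diag n)]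
    (hx : ∀ e ∈ D, ∑ δ, w δ * slalomSign D e δ = x e) {s t a b : ZMod (2 * n)}
    (hst : s(s, t) ∈ E) (hab : IsEdge D a b) (h : Reach D a b t) (hs : sbtw b s a) :
    ∀ p, stripPos D w s t a b < p → p < stripPos D w s t a b + w s(s, t) →
      Leaf D x a b p t := by
  classical
  induction h with
  | last hb ht => exact fun p _ _ => .last hb ht
  | @turnStart a b a' t ha h ih =>
    intro p hp1 hp2
    have ht := h.sbtw hn
    have haa := ha.sbtw
    -- Every diagonal turning around `b` lies beyond `st`, which does not itself turn around `b`; so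
    -- the subtracted weight also covers `w s(s, t)`.
    have hneg : stripPos D w s t a b + w s(s, t) ≤ 0 := by
      have hone : w s(s, t) = ∑ q : ZMod (2 * n) × ZMod (2 * n), w s(q.1, q.2) *
          (if q = (s, t) then 1 else 0) := by simp
      rw [hone]
      unfold stripPos
      rw [← Finset.sum_add_distrib]
      refine Finset.sum_nonpos ?_
      rintro ⟨s', t'⟩ -
      rw [← mul_add]
      by_cases hmem : s(s', t') ∈ E
      swap
      · rw [hw _ hmem]; simp
      refine mul_nonpos_of_nonneg_of_nonpos (hw0 _) ?_
      have h1 : PassesEnd D a b (s', t') → (s', t') ≠ (s, t) := by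
        rintro ⟨-, h1⟩ h2
        cases h2
        exact not_turnsStart_and_turnsEnd hn hD ⟨⟨a', ha, ht⟩, h1⟩
      have h2 : (s', t') = (s, t) → Beyond s t b (s', t') := by
        intro h2
        cases h2
        exact ⟨Or.inl rfl, Or.inl rfl⟩
      have h3 : PassesEnd D a b (s', t') → Beyond s t b (s', t') := by
        rintro ⟨h4, b', hb, h5⟩
        have hnc := not_crosses_pair (hE.noncrossing _ hst _ hmem)
        have hbb := hb.sbtw
        have hbo := not_sbtw_next hn hD ha hb
        have q9 : t' = t ↔ pos a t' = pos a t := (pos_injective a).eq_iff.symm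
        have q10 : s' = s ↔ pos a s' = pos a s := (pos_injective a).eq_iff.symm
        unfold Beyond
        dsimp only at h4 h5 ⊢
        rw [q9, q10]
        clear ih hx h1 h2 q9 q10 hone
        simp only [sbtw_iff_pos a, pos_self] at *
        omega
      exact indicator_sub_add_nonpos h3 h2 h1
    have hp : p < 0 := by linarith
    refine .turnStart ha hp ?_
    -- On a boundary edge `x` is unconstrained by `hx`, but there a leaf ends whatever its position.
    by_cases he : a' = a + 2
    · subst he
      exact (leaf_last_iff hn hD (hab.odd hD).1).2
        ((reach_add_two_iff hn hD ha.edge rfl).1 h)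
    · have hmem := mem_of_isEdge ha.edge he ((ha.flip hab).ne hn hD ha.edge.symm)
      have hpos := stripPos_start hn hD hE hw hx hst hab ha hmem ht hs
      refine ih hst ha.edge ?_ _ (by linarith) (by linarith)
      simp only [sbtw_iff_pos a, pos_self] at *
      omega
  | @turnEnd a b b' t hb h ih =>
    intro p hp1 hp2
    have ht := h.sbtw hn
    have hbb := hb.sbtw
    have hneg : 0 ≤ stripPos D w s t a b := by
      unfold stripPos
      refine Finset.sum_nonneg ?_
      rintro ⟨s', t'⟩ -
      refine mul_nonneg (hw0 _) ?_
      have h3 : Beyond s t b (s', t') → PassesEnd D a b (s', t') := by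
        rintro ⟨h4, h5⟩
        dsimp only at h4 h5
        refine ⟨?_, b', hb, ?_⟩
        · rcases h5 with rfl | h5
          · exact hs
          · dsimp only
            simp only [sbtw_iff_pos a, pos_self] at hs h5 ⊢
            omega
        · rcases h4 with rfl | h4
          · exact ht
          · dsimp only
            clear h5 ih
            simp only [sbtw_iff_pos a, pos_self] at *
            omega
      exact indicator_sub_nonneg h3
    have hp : 0 < p := by linarith
    refine .turnEnd hb hp ?_
    by_cases he : b = b' + 2
    · exact .last he ((reach_add_two_iff hn hD hb.edge he).1 h)
    · have hmem := mem_of_isEdge hb.edge he ((hb.flip hab).ne hn hD)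
      have hpos := stripPos_end (s := s) (t := t) hn hD hE hw hx hab hb hmem
      refine ih hst hb.edge ?_ _ (by linarith) (by linarith)
      simp only [sbtw_iff_pos a, pos_self] at *
      omega

end Uniqueness

/-! ### Comparing arbitrary weights with the lengths of leaf sets. -/

section Uniqueness

open MeasureTheory

variable {n : ℕ} {D E : Set (Diag n)} {x w : Diag n → ℝ} [NeZero n]

/-- At an edge where the diagonal forms a `Z` or an `S`, its leaves fit in a bounded interval.
Finiteness matters because `ENNReal.toReal` sends `⊤` to `0`. -/
theorem volume_leafSet_ne_top (hn : 3 ≤ n) (hD : IsHollowDissection D) {s t a b : ZMod (2 * n)}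
    (hδ : IsAccordionDiag D s(s, t)) (hδ' : ¬ IsBoundaryEdge s(s, t)) (hab : IsEdge D a b)
    (ht : sbtw a t b) (hs : sbtw b s a) : volume (leafSet D x a b s t) ≠ ⊤ := by
  have key : ∀ {s t : ZMod (2 * n)} {c d : ZMod (2 * n)}, s(c, d) ∈ D →
      (FormsZ D s(c, d) s(s, t) ∨ FormsS D s(c, d) s(s, t)) → sbtw c t d → sbtw d s c →
      volume (leafSet D x c d s t) ≠ ⊤ := by
    intro s t c d he hZS ht hs
    have hcd : IsEdge D c d := Or.inl he
    rw [formsZ_iff hn hD hcd ht hs, formsS_iff hn hD hcd ht hs] at hZS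
    rcases hZS with ⟨h1, h2⟩ | ⟨h1, h2⟩
    · refine ne_top_of_le_ne_top ?_ (measure_mono (leafSet_subset_of_turnsEnd hn hD hcd h1 h2))
      rw [Real.volume_Ioo]; exact ENNReal.ofReal_ne_top
    · refine ne_top_of_le_ne_top ?_ (measure_mono (leafSet_subset_of_turnsStart hn hD hcd h1 h2))
      rw [Real.volume_Ioo]; exact ENNReal.ofReal_ne_top
  obtain ⟨es, et, -⟩ := hδ.even
  obtain ⟨e, he, hZS⟩ := hδ.exists_sign hn hD hδ'
  have hc : Crosses e s(s, t) := hZS.elim FormsZ.crosses FormsS.crosses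
  rw [volume_leafSet_eq hn hD hab (hδ.reach hn hD es et a b hab ht hs) hs]
  have : ∃ c d, e = s(c, d) ∧ sbtw c t d ∧ sbtw d s c := by
    induction e using Sym2.ind with
    | _ c d =>
      rcases crosses_iff.1 hc with h | h
      · exact ⟨c, d, rfl, h⟩
      · exact ⟨d, c, Sym2.eq_swap, h.symm⟩
  obtain ⟨c, d, rfl, h1, h2⟩ := this
  have hcd : IsEdge D c d := Or.inl he
  rw [← volume_leafSet_eq hn hD hcd (hδ.reach hn hD es et c d hcd h1 h2) h2]
  exact key he hZS h1 h2

theorem le_leafWeight (hn : 3 ≤ n) (hD : IsHollowDissection D)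
    (hE : IsAccordionDissection D E) (hw0 : ∀ δ, 0 ≤ w δ)
    (hw : ∀ δ, δ ∉ E → w δ = 0) [Fintype (Diag n)]
    (hx : ∀ e ∈ D, ∑ δ, w δ * slalomSign D e δ = x e) (δ : Diag n) :
    w δ ≤ leafWeight D x δ := by
  by_cases hδ : δ ∈ E
  swap
  · rw [hw δ hδ]; exact leafWeight_nonneg δ
  induction δ using Sym2.ind with
  | _ s t =>
    have hacc := hE.accordion _ hδ
    have hint := hE.internal _ hδ
    obtain ⟨es, et, hst⟩ := hacc.even
    have b1 := sbtw_around hn s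
    have b2 := sbtw_around' hn et es hst.symm
    have hab := (isEdge_around_even (D := D) hn es).symm
    have hr := hacc.reach hn hD es et _ _ hab b2 b1
    rw [leafWeight_eq hn hD hacc hint hab b2 b1]
    have hleaf := leaf_of_mem_strip hn hD hE hw0 hw hx hδ hab hr b1
    set r := stripPos D w s t (s + 1) (s - 1) with hr
    -- `stripPos` is a position after crossing while `leafSet` uses the one before, hence the
    -- subtraction. At the boundary edge around `s` the backward leaf ends at once.
    have hsub : Set.Ioo (r - x s(s + 1, s - 1)) (r + w s(s, t) - x s(s + 1, s - 1)) ⊆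
        leafSet D x (s + 1) (s - 1) s t := by
      rintro p ⟨h1, h2⟩
      refine ⟨hleaf _ (by linarith) (by linarith), .last (by ring) (by ring)⟩
    have hvol := measure_mono (μ := volume) hsub
    rw [Real.volume_Ioo] at hvol
    have := ENNReal.toReal_mono (volume_leafSet_ne_top hn hD hacc hint hab b2 b1) hvol
    rwa [ENNReal.toReal_ofReal (by linarith [hw0 s(s, t)]), show
      r + w s(s, t) - x s(s + 1, s - 1) - (r - x s(s + 1, s - 1)) = w s(s, t) by ring] at this

/-- A weighted lamination is determined by its shear coordinates. -/
theorem eq_leafWeight (hn : 3 ≤ n) (hD : IsHollowDissection D)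
    (hE : IsAccordionDissection D E) (hw0 : ∀ δ, 0 ≤ w δ)
    (hw : ∀ δ, δ ∉ E → w δ = 0) [Fintype (Diag n)]
    (hx : ∀ e ∈ D, ∑ δ, w δ * slalomSign D e δ = x e) : w = leafWeight D x := by
  classical
  have hle := le_leafWeight hn hD hE hw0 hw hx
  funext δ
  by_cases hδ : IsAccordionDiag D δ ∧ ¬ IsBoundaryEdge δ
  swap
  · rw [leafWeight_of_not hδ]
    exact hw _ fun h => hδ ⟨hE.accordion _ h, hE.internal _ h⟩
  obtain ⟨e, he, hZS⟩ := hδ.1.exists_sign hn hD hδ.2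
  have hZ := sum_leafWeight_formsZ hn hD x he
  have hS := sum_leafWeight_formsS hn hD x he
  have hx' := hx e he
  simp only [slalomSign_eq hn hD, mul_sub, Finset.sum_sub_distrib] at hx'
  have key : ∀ P : Diag n → Prop, ∀ γ, w γ * (if P γ then 1 else 0) ≤
      leafWeight D x γ * (if P γ then 1 else 0) := by
    intro P γ
    split_ifs
    · simpa using hle γ
    · simp
  have hZle := Finset.sum_le_sum fun γ (_ : γ ∈ Finset.univ) => key (FormsZ D e) γ
  have hSle := Finset.sum_le_sum fun γ (_ : γ ∈ Finset.univ) => key (FormsS D e) γ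
  have hZ0 : 0 ≤ ∑ γ, w γ * (if FormsZ D e γ then 1 else 0) :=
    Finset.sum_nonneg fun γ _ => mul_nonneg (hw0 γ) (by split_ifs <;> norm_num)
  have hS0 : 0 ≤ ∑ γ, w γ * (if FormsS D e γ then 1 else 0) :=
    Finset.sum_nonneg fun γ _ => mul_nonneg (hw0 γ) (by split_ifs <;> norm_num)
  -- One of the two totals of `leafWeight` vanishes, hence so does that of `w`, which is nonnegative
  -- and no larger. As the differences of totals agree, the other totals agree too, and then
  -- termwise.
  have hmax : (max (x e) 0 = x e ∧ max (-x e) 0 = 0) ∨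
      (max (x e) 0 = 0 ∧ max (-x e) 0 = -x e) := by
    rcases le_total 0 (x e) with h | h
    · exact Or.inl ⟨max_eq_left h, max_eq_right (by linarith)⟩
    · exact Or.inr ⟨max_eq_right h, max_eq_left (by linarith)⟩
  rw [hZ] at hZle
  rw [hS] at hSle
  rcases hZS with h | h
  · have heq : ∑ γ, w γ * (if FormsZ D e γ then 1 else 0) =
        ∑ γ, leafWeight D x γ * (if FormsZ D e γ then 1 else 0) := by
      rw [hZ]
      rcases hmax with ⟨h1, h2⟩ | ⟨h1, h2⟩ <;> linarith
    have := (Finset.sum_eq_sum_iff_of_le fun γ _ => key (FormsZ D e) γ).1 heq δ (Finset.mem_univ _)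
    simpa [h] using this
  · have heq : ∑ γ, w γ * (if FormsS D e γ then 1 else 0) =
        ∑ γ, leafWeight D x γ * (if FormsS D e γ then 1 else 0) := by
      rw [hS]
      rcases hmax with ⟨h1, h2⟩ | ⟨h1, h2⟩ <;> linarith
    have := (Finset.sum_eq_sum_iff_of_le fun γ _ => key (FormsS D e) γ).1 heq δ (Finset.mem_univ _)
    simpa [h] using this

end Uniqueness

/-! ### The g-vector fan -/

section Fan

variable {n : ℕ} {D E : Set (Diag n)}

theorem IsAccordionDissection.subset (hE : IsAccordionDissection D E) {E' : Set (Diag n)}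
    (h : E' ⊆ E) : IsAccordionDissection D E' :=
  ⟨fun δ hδ => hE.accordion δ (h hδ), fun δ hδ => hE.internal δ (h hδ),
    fun γ hγ δ hδ => hE.noncrossing γ (h hγ) δ (h hδ)⟩

/-- The vector with the given coordinates, extended by zero. -/
noncomputable def extendZero (D : Set (Diag n)) (v : D → ℝ) : Diag n → ℝ :=
  Function.extend Subtype.val v 0

theorem extendZero_apply (v : D → ℝ) (e : D) : extendZero D v e = v e :=
  Subtype.val_injective.extend_apply _ _ _

/-- The coordinates of a vector in the g-vector fan. -/
noncomputable def fanCoord (D : Set (Diag n)) (v : D → ℝ) (δ : Diag n) : ℝ :=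
  leafWeight D (extendZero D v) δ

theorem fanCoord_nonneg (v : D → ℝ) (δ : Diag n) : 0 ≤ fanCoord D v δ := leafWeight_nonneg δ

theorem mem_gCone_iff [Fintype (Diag n)] {v : D → ℝ} : v ∈ gCone D E ↔
    ∃ w : Diag n → ℝ, (∀ δ, 0 ≤ w δ) ∧ (∀ δ, δ ∉ E → w δ = 0) ∧
      ∑ δ, w δ • gVector D δ = v := by
  classical
  constructor
  · intro h
    induction h using Submodule.span_induction with
    | mem v h =>
      obtain ⟨δ, hδ, rfl⟩ := h
      refine ⟨Pi.single δ 1, fun γ => ?_, fun γ hγ => ?_, ?_⟩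
      · by_cases h : γ = δ
        · subst h; simp
        · simp [h]
      · exact Pi.single_eq_of_ne (fun h : γ = δ => hγ (by rw [h]; exact hδ)) _
      · rw [Finset.sum_eq_single δ] <;> simp +contextual
    | zero => exact ⟨0, fun _ => le_rfl, fun _ _ => rfl, by simp⟩
    | add v v' _ _ h h' =>
      obtain ⟨w, h1, h2, rfl⟩ := h
      obtain ⟨w', h1', h2', rfl⟩ := h'
      refine ⟨w + w', fun δ => add_nonneg (h1 δ) (h1' δ), fun δ hδ => ?_, ?_⟩
      · simp [h2 δ hδ, h2' δ hδ]
      · simp [add_smul, Finset.sum_add_distrib]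
    | smul c v _ h =>
      obtain ⟨w, h1, h2, rfl⟩ := h
      refine ⟨fun δ => c.1 * w δ, fun δ => mul_nonneg c.2 (h1 δ), fun δ hδ => ?_, ?_⟩
      · simp [h2 δ hδ]
      · rw [Finset.smul_sum]
        refine Finset.sum_congr rfl fun δ _ => ?_
        rw [mul_smul]; rfl
  · rintro ⟨w, h1, h2, rfl⟩
    refine Submodule.sum_mem _ fun δ _ => ?_
    by_cases hδ : δ ∈ E
    · exact PointedCone.smul_mem _ (h1 δ) (Submodule.subset_span ⟨δ, hδ, rfl⟩)
    · rw [h2 δ hδ, zero_smul]; exact Submodule.zero_mem _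

theorem gVector_mem_gCone {δ : Diag n} (hδ : δ ∈ E) : gVector D δ ∈ gCone D E :=
  Submodule.subset_span ⟨δ, hδ, rfl⟩

theorem gCone_mono {E' : Set (Diag n)} (h : E ⊆ E') : gCone D E ≤ gCone D E' :=
  Submodule.span_mono (Set.image_mono h)

variable [NeZero n]

theorem sum_fanCoord_smul (hn : 3 ≤ n) (hD : IsHollowDissection D) [Fintype (Diag n)]
    (v : D → ℝ) : ∑ δ, fanCoord D v δ • gVector D δ = v := by
  funext e
  have h := sum_leafWeight_mul_slalomSign hn hD (extendZero D v) e.2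
  rw [extendZero_apply v e] at h
  simpa [fanCoord, gVector] using h

/-- Representations with non-crossing support are unique. -/
theorem fanCoord_sum (hn : 3 ≤ n) (hD : IsHollowDissection D) [Fintype (Diag n)]
    (hE : IsAccordionDissection D E) {w : Diag n → ℝ} (h0 : ∀ δ, 0 ≤ w δ)
    (h1 : ∀ δ, δ ∉ E → w δ = 0) : fanCoord D (∑ δ, w δ • gVector D δ) = w := by
  symm
  refine eq_leafWeight hn hD hE h0 h1 fun e he => ?_
  rw [extendZero_apply _ ⟨e, he⟩]
  simp [gVector]

theorem isAccordionDissection_fanCoord_pos (hn : 3 ≤ n) (hD : IsHollowDissection D) (v : D → ℝ) :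
    IsAccordionDissection D {δ | 0 < fanCoord D v δ} := by
  have h : ∀ δ, 0 < fanCoord D v δ → IsAccordionDiag D δ ∧ ¬ IsBoundaryEdge δ := by
    intro δ hδ
    by_contra h'
    rw [fanCoord, leafWeight_of_not h'] at hδ
    exact lt_irrefl _ hδ
  exact ⟨fun δ hδ => (h δ hδ).1, fun δ hδ => (h δ hδ).2,
    fun γ hγ δ hδ => not_crosses_of_leafWeight_pos hn hD hγ hδ⟩

theorem mem_gCone_iff_fanCoord (hn : 3 ≤ n) (hD : IsHollowDissection D)
    (hE : IsAccordionDissection D E) {v : D → ℝ} :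
    v ∈ gCone D E ↔ ∀ δ, δ ∉ E → fanCoord D v δ = 0 := by
  have := Fintype.ofFinite (Diag n)
  rw [mem_gCone_iff]
  constructor
  · rintro ⟨w, h0, h1, rfl⟩
    rwa [fanCoord_sum hn hD hE h0 h1]
  · intro h
    exact ⟨fanCoord D v, fanCoord_nonneg v, h, sum_fanCoord_smul hn hD v⟩

/-- The coordinates are linear only within a cone: the sum of the two expansions must still have
non-crossing support. -/
theorem fanCoord_add (hn : 3 ≤ n) (hD : IsHollowDissection D)
    (hE : IsAccordionDissection D E) {v v' : D → ℝ} (h : v ∈ gCone D E) (h' : v' ∈ gCone D E) :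
    fanCoord D (v + v') = fanCoord D v + fanCoord D v' := by
  have := Fintype.ofFinite (Diag n)
  rw [mem_gCone_iff_fanCoord hn hD hE] at h h'
  conv_lhs => rw [← sum_fanCoord_smul hn hD v, ← sum_fanCoord_smul hn hD v',
    ← Finset.sum_add_distrib]
  simp only [← add_smul]
  exact fanCoord_sum hn hD hE (fun δ => add_nonneg (fanCoord_nonneg v δ) (fanCoord_nonneg v' δ))
    (fun δ hδ => by rw [h δ hδ, h' δ hδ, add_zero])

theorem fanCoord_smul (hn : 3 ≤ n) (hD : IsHollowDissection D) {c : ℝ} (hc : 0 ≤ c)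
    (v : D → ℝ) : fanCoord D (c • v) = c • fanCoord D v := by
  have := Fintype.ofFinite (Diag n)
  conv_lhs => rw [← sum_fanCoord_smul hn hD v, Finset.smul_sum]
  simp only [smul_smul]
  refine fanCoord_sum hn hD (isAccordionDissection_fanCoord_pos hn hD v)
    (fun δ => mul_nonneg hc (fanCoord_nonneg v δ)) (fun δ hδ => ?_)
  rw [le_antisymm (not_lt.1 hδ) (fanCoord_nonneg v δ), mul_zero]

theorem fanCoord_gVector (hn : 3 ≤ n) (hD : IsHollowDissection D) [DecidableEq (Diag n)]
    (hE : IsAccordionDissection D E) {δ : Diag n} (hδ : δ ∈ E) :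
    fanCoord D (gVector D δ) = Pi.single δ 1 := by
  have := Fintype.ofFinite (Diag n)
  have h : ∑ γ, (Pi.single δ 1 : Diag n → ℝ) γ • gVector D γ = gVector D δ := by
    rw [Finset.sum_eq_single δ] <;> simp +contextual
  conv_lhs => rw [← h]
  refine fanCoord_sum hn hD hE (fun γ => ?_) fun γ hγ => ?_
  · by_cases h : γ = δ
    · subst h; simp
    · simp [h]
  · exact Pi.single_eq_of_ne (fun h : γ = δ => hγ (by rw [h]; exact hδ)) _

theorem gVector_mem_gCone_iff (hn : 3 ≤ n) (hD : IsHollowDissection D) {E' : Set (Diag n)}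
    (hE : IsAccordionDissection D E) (hE' : IsAccordionDissection D E') {δ : Diag n}
    (hδ : δ ∈ E) : gVector D δ ∈ gCone D E' ↔ δ ∈ E' := by
  classical
  refine ⟨fun h => ?_, gVector_mem_gCone⟩
  by_contra h'
  have := (mem_gCone_iff_fanCoord hn hD hE').1 h δ h'
  rw [fanCoord_gVector hn hD hE hδ] at this
  simp at this

theorem gCone_isFaceOf (hn : 3 ≤ n) (hD : IsHollowDissection D) {E' : Set (Diag n)}
    (hE' : IsAccordionDissection D E') (h : E ⊆ E') : (gCone D E).IsFaceOf (gCone D E') := by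
  have hE := hE'.subset h
  refine ⟨gCone_mono h, fun {v v' a} hv hv' ha hsum => ?_⟩
  rw [mem_gCone_iff_fanCoord hn hD hE] at hsum ⊢
  intro δ hδ
  have h1 := hsum δ hδ
  rw [fanCoord_add hn hD hE' (PointedCone.smul_mem _ ha.le hv) hv', fanCoord_smul hn hD ha.le] at h1
  have h2 := fanCoord_nonneg v δ
  have h3 := fanCoord_nonneg v' δ
  simp only [Pi.add_apply, Pi.smul_apply, smul_eq_mul] at h1
  -- Two nonnegative terms with sum zero both vanish.
  have h4 : a * fanCoord D v δ = 0 := by nlinarith [mul_nonneg ha.le h2]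
  exact (mul_eq_zero.1 h4).resolve_left ha.ne'

theorem gCone_isFaceOf_iff (hn : 3 ≤ n) (hD : IsHollowDissection D) {E' : Set (Diag n)}
    (hE : IsAccordionDissection D E) (hE' : IsAccordionDissection D E') :
    (gCone D E).IsFaceOf (gCone D E') ↔ E ⊆ E' :=
  ⟨fun h _ hδ => (gVector_mem_gCone_iff hn hD hE hE' hδ).1 (h.le (gVector_mem_gCone hδ)),
    gCone_isFaceOf hn hD hE'⟩

theorem gCone_inf (hn : 3 ≤ n) (hD : IsHollowDissection D) {E' : Set (Diag n)}
    (hE : IsAccordionDissection D E) (hE' : IsAccordionDissection D E') :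
    gCone D E ⊓ gCone D E' = gCone D (E ∩ E') := by
  refine le_antisymm (fun v ⟨h, h'⟩ => ?_)
    (le_inf (gCone_mono Set.inter_subset_left) (gCone_mono Set.inter_subset_right))
  have h := (mem_gCone_iff_fanCoord hn hD hE).1 h
  have h' := (mem_gCone_iff_fanCoord hn hD hE').1 h'
  rw [mem_gCone_iff_fanCoord hn hD (hE.subset Set.inter_subset_left)]
  intro δ hδ
  by_cases h1 : δ ∈ E
  · exact h' δ fun h2 => hδ ⟨h1, h2⟩
  · exact h δ h1

theorem linearIndepOn_gVector (hn : 3 ≤ n) (hD : IsHollowDissection D)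
    (hE : IsAccordionDissection D E) : LinearIndepOn ℝ (gVector D) E := by
  classical
  have := Fintype.ofFinite (Diag n)
  have : Fintype E := Fintype.ofFinite E
  rw [LinearIndepOn, Fintype.linearIndependent_iff]
  intro c hc δ
  set c' : Diag n → ℝ := Function.extend Subtype.val c 0 with hc'
  have hout : ∀ γ, γ ∉ E → c' γ = 0 := fun γ hγ =>
    Function.extend_apply' _ _ _ (by rintro ⟨γ', rfl⟩; exact hγ γ'.2)
  have hin : ∀ γ : E, c' γ = c γ := fun γ => Subtype.val_injective.extend_apply _ _ _
  have hsum : ∑ γ, c' γ • gVector D γ = 0 := by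
    rw [← Finset.sum_subset (Finset.subset_univ (Finset.univ.filter (· ∈ E))) fun γ _ hγ => by
      rw [hout γ (by simpa using hγ), zero_smul]]
    rw [Finset.sum_subtype _ (p := (· ∈ E)) (by simp), ← hc]
    exact Finset.sum_congr rfl fun γ _ => by rw [hin]
  -- A linear relation is split into its positive and negative parts, two nonnegative expansions of
  -- one vector supported in `E`; uniqueness makes them equal.
  have hpm : ∑ γ, max (c' γ) 0 • gVector D γ = ∑ γ, max (-c' γ) 0 • gVector D γ := by
    rw [← sub_eq_zero, ← Finset.sum_sub_distrib, ← hsum]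
    refine Finset.sum_congr rfl fun γ _ => ?_
    rw [← sub_smul]
    congr 1
    rcases le_total 0 (c' γ) with h | h
    · rw [max_eq_left h, max_eq_right (by linarith)]; ring
    · rw [max_eq_right h, max_eq_left (by linarith)]; ring
  have h1 := fanCoord_sum hn hD hE (w := fun γ => max (c' γ) 0) (fun γ => le_max_right _ _)
    (fun γ hγ => by simp [hout γ hγ])
  have h2 := fanCoord_sum hn hD hE (w := fun γ => max (-c' γ) 0) (fun γ => le_max_right _ _)
    (fun γ hγ => by simp [hout γ hγ])
  rw [hpm, h2] at h1
  have h3 := congrFun h1 δ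
  rw [← hin]
  rcases le_total 0 (c' δ) with h | h
  · rw [max_eq_left h, max_eq_right (by linarith)] at h3; exact h3.symm
  · rw [max_eq_right h, max_eq_left (by linarith)] at h3; linarith

theorem face_mem_gVectorFan (hn : 3 ≤ n) (hD : IsHollowDissection D)
    (hE : IsAccordionDissection D E) {C : PointedCone ℝ (D → ℝ)} (hC : C.IsFaceOf (gCone D E)) :
    C ∈ gVectorFan D := by
  have := Fintype.ofFinite (Diag n)
  have hsub : {δ ∈ E | gVector D δ ∈ C} ⊆ E := fun δ hδ => hδ.1
  refine ⟨{δ ∈ E | gVector D δ ∈ C}, hE.subset hsub, le_antisymm ?_ fun v hv => ?_⟩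
  · refine Submodule.span_le.2 ?_
    rintro _ ⟨δ, hδ, rfl⟩
    exact hδ.2
  · have hvE := (mem_gCone_iff_fanCoord hn hD hE).1 (hC.le hv)
    rw [mem_gCone_iff_fanCoord hn hD (hE.subset hsub)]
    intro δ hδ
    by_cases hδE : δ ∈ E
    · by_contra hne
      have hpos : 0 < fanCoord D v δ := lt_of_le_of_ne (fanCoord_nonneg v δ) (Ne.symm hne)
      apply hδ
      refine ⟨hδE, ?_⟩
      classical
      rw [← sum_fanCoord_smul hn hD v, ← Finset.add_sum_erase _ _ (Finset.mem_univ δ)] at hv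
      -- A face containing a sum of elements of the cone contains each generator used with positive
      -- coefficient.
      refine hC.mem_of_smul_add_mem (gVector_mem_gCone hδE) ?_ hpos hv
      refine Submodule.sum_mem _ fun γ _ => ?_
      by_cases hγ : γ ∈ E
      · exact PointedCone.smul_mem _ (fanCoord_nonneg v γ) (gVector_mem_gCone hγ)
      · rw [hvE γ hγ, zero_smul]; exact Submodule.zero_mem _
    · exact hvE δ hδE

theorem isCompleteSimplicialFan_gVectorFan (hn : 3 ≤ n) (hD : IsHollowDissection D) :
    IsCompleteSimplicialFan (gVectorFan D) where
  finite := (Set.toFinite _).image _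
  simplicial := by
    rintro _ ⟨E, hE, rfl⟩
    exact PointedCone.IsSimplicial.hull (Set.toFinite _)
      (linearIndepOn_gVector hn hD hE).id_image
  face_mem := by
    rintro _ ⟨E, hE, rfl⟩ C' hC'
    exact face_mem_gVectorFan hn hD hE hC'
  inter_isFaceOf := by
    rintro _ ⟨E, hE, rfl⟩ _ ⟨E', hE', rfl⟩
    rw [gCone_inf hn hD hE hE']
    exact ⟨gCone_isFaceOf hn hD hE Set.inter_subset_left,
      gCone_isFaceOf hn hD hE' Set.inter_subset_right⟩
  complete := fun v => ⟨_, ⟨_, isAccordionDissection_fanCoord_pos hn hD v, rfl⟩,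
    (mem_gCone_iff_fanCoord hn hD (isAccordionDissection_fanCoord_pos hn hD v)).2 fun δ hδ =>
      le_antisymm (not_lt.1 hδ) (fanCoord_nonneg v δ)⟩

end Fan

theorem mainTheorem1 (n : ℕ) (hn : 3 ≤ n) (D : Set (Diag n)) (hD : IsHollowDissection D) :
    IsCompleteSimplicialFan (gVectorFan D) ∧
    (∀ E ∈ accordionComplex D, LinearIndepOn ℝ (gVector D) E) ∧
    (∀ E ∈ accordionComplex D, ∀ E' ∈ accordionComplex D,
      ((gCone D E).IsFaceOf (gCone D E') ↔ E ⊆ E')) ∧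
    (∀ E ∈ accordionComplex D, ∀ E' ∈ accordionComplex D,
      gCone D E ⊓ gCone D E' = gCone D (E ∩ E')) := by
  have : NeZero n := ⟨by omega⟩
  exact ⟨isCompleteSimplicialFan_gVectorFan hn hD,
    fun E hE => linearIndepOn_gVector hn hD hE,
    fun E hE E' hE' => gCone_isFaceOf_iff hn hD hE hE',
    fun E hE E' hE' => gCone_inf hn hD hE hE'⟩
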